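/- Let $p$ be a prime and let $R$ be a noetherian $F$-finite normal local domain of characteristic $p$ with fraction field $K$. Let $\Gamma$ be a finite abelian group and let $S=\bigoplus_{\gamma\in\Gamma}S_\gamma$ be a commutative $\Gamma$-graded ring with $S_0=R$, finite as an $R$-module. Write $\theta\colon R\to S$ for the inclusion and $f\colon \operatorname{Spec}S\to\operatorname{Spec}R$ for the induced map. Suppose that $S_\gamma= R(D_\gamma)=\{g\in K: g=0\text{ or }\operatorname{div}g+D_\gamma\ge 0\}$ for Weil divisors $D_\gamma$ on $\operatorname{Spec}R$ with $D_0=0$, and that the multiplication of $S$ is $R(D_\gamma)\times R(D_{\gamma'})\to R(D_{\gamma+\gamma'})$, $(a,b)\mapsto\kappa_{\gamma,\gamma'}ab$, for some $\kappa_{\gamma,\gamma'}\in K^\times$ with $\operatorname{div}\kappa_{\gamma,\gamma'}+D_{\gamma+\gamma'}=D_\gamma+D_{\gamma'}$. Assume that the homomorphism $\Gamma\to\operatorname{Cl}R$, $\gamma\mapsto[D_\gamma]$, is injective. Let $\mathfrak T\colon S\to S_0=R$ be the projection onto degree zero. Let $e\ge 1$ and $q=p^e$. For a ring $A$ of characteristic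 $p$, a Cartier pair $(A,\varphi)$ consists of $A$ and an $A$-linear map $\varphi\colon F^e_*A\to A$, i.e. an additive map $\varphi\colon A\to A$ with $\varphi(a^qb)=a\varphi(b)$. An ideal $\mathfrak a$ of $A$ is a $\varphi$-ideal if $\varphi(F^e_*\mathfrak a)\subseteq\mathfrak a$. Put $\mathrm{CSpec}(A,\varphi)=\{\mathfrak p\in\operatorname{Spec}A:\mathfrak p\text{ is a }\varphi\text{-ideal}\}$, and let $\mathrm{Schpec}(A,\varphi)$ (the set of centers of $F$-purity) be the set of $\mathfrak p\in\mathrm{CSpec}(A,\varphi)$ for which the map $\bar\varphi_{\mathfrak p}\colon F^e_*\kappa(\mathfrak p)\to\kappa(\mathfrak p)$ induced by $\varphi$ is nonzero; it carries the subspace topology from $\operatorname{Spec}A$. The Cartier--Zariski topology on $\operatorname{Spec}A$ is the one whose closed sets are the $V(\mathfrak a)$ with $\mathfrak a$ a $\varphi$-ideal. The pair $(A,\varphi)$ is $F$-pure if for every $\mathfrak p\in\operatorname{Spec}A$ the ideal $\bigcap_{n\ge1}\{a\in A:\varphi^n(F^{en}_*aA)\subseteq\mathfrak p\}$ is proper (equivalently,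 if $\varphi$ is surjective). For $\mathfrak p\in\operatorname{Spec}R$ put $\mathfrak p^{\mathfrak T}=\{s\in S:\mathfrak T(sS)\subseteq\mathfrak p\}$ and $Y_{\mathfrak p}=f^{-1}\{\mathfrak p\}$; $\theta$ is tamely $\mathfrak T$-ramified over $\mathfrak p$ if $\mathfrak p^{\mathfrak T}=\sqrt{\mathfrak pS}$. A $\mathfrak T$-transpose of $\varphi\colon F^e_*R\to R$ is an $S$-linear map $\psi\colon F^e_*S\to S$ with $\mathfrak T\circ\psi=\varphi\circ F^e_*\mathfrak T$; the transposition $(\theta,\mathfrak T)\colon(R,\varphi)\to(S,\psi)$ is fibered if (a) $f$ is continuous for the Cartier--Zariski topologies of $(S,\psi)$ and $(R,\varphi)$; (b) $\mathfrak p^{\mathfrak T}$ is radical for all $\mathfrak p\in\mathrm{CSpec}(R,\varphi)$, and $\varphi,\psi,\mathfrak T$ induce maps $\bar\varphi_{\mathfrak p}\colon F^e_*\kappa(\mathfrak p)\to\kappa(\mathfrak p)$, $\bar\psi_{\mathfrak p}\colon F^e_*\bar S_{\mathfrak p}\to\bar S_{\mathfrak p}$ and $\bar{\mathfrak T}_{\mathfrak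 p}\colon\bar S_{\mathfrak p}\to\kappa(\mathfrak p)$ with $\bar{\mathfrak T}_{\mathfrak p}\circ\bar\psi_{\mathfrak p}=\bar\varphi_{\mathfrak p}\circ F^e_*\bar{\mathfrak T}_{\mathfrak p}$, where $\bar S_{\mathfrak p}=(S\otimes_R\kappa(\mathfrak p))_{\mathrm{red}}$; (c) for all $\mathfrak p\in\mathrm{CSpec}(R,\varphi)$: if $\bar\varphi_{\mathfrak p}\ne0$ then $(\bar S_{\mathfrak p},\bar\psi_{\mathfrak p})$ is $F$-pure; (d) for all $\mathfrak p\in\mathrm{CSpec}(R,\varphi)$: if $\bar\varphi_{\mathfrak p}=0$ then $\bar\psi_{\mathfrak p}=0$. Let $(R,\phi)$ be an $F$-pure Cartier pair. Then $\phi$ has a unique $\mathfrak T$-transpose $\phi^{\mathfrak T}\colon F^e_*S\to S$; $\theta$ is tamely $\mathfrak T$-ramified over every $\mathfrak p\in\mathrm{Schpec}(R,\phi)$; and the transposition $(\theta,\mathfrak T)\colon(R,\phi)\to(S,\phi^{\mathfrak T})$ is fibered. Furthermore, for all $\mathfrak p\in\operatorname{Spec}R$, $$\mathfrak p\in\mathrm{Schpec}(R,\phi)\iff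 Y_{\mathfrak p}\subseteq\mathrm{Schpec}(S,\phi^{\mathfrak T})\iff Y_{\mathfrak p}\cap\mathrm{Schpec}(S,\phi^{\mathfrak T})\neq\emptyset .$$ If $\Gamma$ is a $p$-group, then $f$ restricts to a homeomorphism $\mathrm{Schpec}(S,\phi^{\mathfrak T})\to\mathrm{Schpec}(R,\phi)$. -/

import Mathlib

noncomputable section

/-! ### Cartier pairs, compatible ideals and centers of `F`-purity -/

/-- An `A`-linear map `F^e_* A → A`, i.e. an additive map `φ : A → A`
such that `φ (a ^ (p ^ e) * b) = a * φ b`. -/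
structure CartierMap (p e : ℕ) (A : Type*) [CommRing A] extends A →+ A where
  map_pow_mul' : ∀ a b : A, toFun (a ^ p ^ e * b) = a * toFun b

namespace CartierMap

variable {p e : ℕ} {A : Type*} [CommRing A]

instance : CoeFun (CartierMap p e A) (fun _ => A → A) := ⟨fun φ => φ.toFun⟩

/-- The `n`-th iterate `φ ^ n : F^{en}_* A → A`. -/
def pow (φ : CartierMap p e A) (n : ℕ) : CartierMap p (e * n) A where
  toFun := φ^[n]
  map_zero' := iterate_map_zero φ.toAddMonoidHom n
  map_add' := iterate_map_add φ.toAddMonoidHom n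
  map_pow_mul' := by
    intro a b
    induction n generalizing b with
    | zero => simp
    | succ n ih =>
      have h : a ^ p ^ (e * (n + 1)) = (a ^ p ^ (e * n)) ^ p ^ e := by
        rw [← pow_mul, ← pow_add]; ring_nf
      rw [Function.iterate_succ_apply, Function.iterate_succ_apply, h, φ.map_pow_mul', ih]

/-- The ideal `𝔞 ^ φ`: the largest ideal `𝔟` such that `φ (F^e_* 𝔟) ⊆ 𝔞`. -/
def transposeIdeal (φ : CartierMap p e A) (I : Ideal A) : Ideal A where
  carrier := {a | ∀ x, φ (a * x) ∈ I}
  zero_mem' := by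
    intro x
    have h : φ 0 = 0 := φ.toAddMonoidHom.map_zero
    simp [h]
  add_mem' := by
    intro a b ha hb x
    have h : φ (a * x + b * x) = φ (a * x) + φ (b * x) := φ.toAddMonoidHom.map_add _ _
    rw [add_mul, h]
    exact I.add_mem (ha x) (hb x)
  smul_mem' := by
    intro c a ha x
    have h : c • a * x = a * (c * x) := by simp only [smul_eq_mul]; ring
    rw [h]
    exact ha _

/-- `𝔞` is a `φ`-ideal if `φ (F^e_* 𝔞) ⊆ 𝔞`. -/
def IsCompatible (φ : CartierMap p e A) (I : Ideal A) : Prop := ∀ a ∈ I, φ a ∈ I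

/-- The Cartier core `κ_𝔞 (A, φ)`: the intersection of all `𝔞 ^ (φ ^ n)`, `n ≥ 1`. -/
def core (φ : CartierMap p e A) (I : Ideal A) : Ideal A :=
  ⨅ n : ℕ, ⨅ _ : 1 ≤ n, (φ.pow n).transposeIdeal I

/-- The non-`F`-pure locus of `(A, φ)`. -/
def nonFPureLocus (φ : CartierMap p e A) : Set (PrimeSpectrum A) :=
  {P | φ.core P.asIdeal = ⊤}

/-- `(A, φ)` is `F`-pure if its non-`F`-pure locus is empty. -/
def IsFPure (φ : CartierMap p e A) : Prop := φ.nonFPureLocus = ∅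

/-- A ring homomorphism `g : A → B` is a homomorphism of Cartier pairs
`(A, φ) → (B, ψ)` if `ψ ∘ F^e_* g = g ∘ φ`. -/
def IsHom {B : Type*} [CommRing B] (g : A →+* B) (φ : CartierMap p e A)
    (ψ : CartierMap p e B) : Prop :=
  ∀ a, ψ (g a) = g (φ a)

/-- The Cartier spectrum: the prime `φ`-ideals. -/
def CSpec (φ : CartierMap p e A) : Set (PrimeSpectrum A) :=
  {P | φ.IsCompatible P.asIdeal}

/-- The Schwede spectrum: the centers of `F`-purity, i.e. the prime `φ`-ideals `P` such that
the map `F^e_* κ(P) → κ(P)` induced by `φ` on the residue field is nonzero. -/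
def Schpec (φ : CartierMap p e A) : Set (PrimeSpectrum A) :=
  {P | P ∈ φ.CSpec ∧ ∃ φP : CartierMap p e P.asIdeal.ResidueField,
    IsHom (algebraMap A P.asIdeal.ResidueField) φ φP ∧ ∃ x, φP x ≠ 0}

theorem isCompatible_iSup (φ : CartierMap p e A) {ι : Type*} (I : ι → Ideal A)
    (hI : ∀ i, φ.IsCompatible (I i)) : φ.IsCompatible (⨆ i, I i) := by
  intro a ha
  refine Submodule.iSup_induction I (motive := fun x => φ x ∈ ⨆ i, I i) ha ?_ ?_ ?_
  · exact fun i x hx => (le_iSup I i) (hI i x hx)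
  · have h : φ 0 = 0 := φ.toAddMonoidHom.map_zero
    rw [h]; exact Submodule.zero_mem _
  · intro x y hx hy
    have h : φ (x + y) = φ x + φ y := φ.toAddMonoidHom.map_add _ _
    rw [h]; exact Submodule.add_mem _ hx hy

/-- The Cartier-Zariski topology on `Spec A`: the closed sets are the `V(𝔞)`
with `𝔞` a `φ`-ideal. -/
@[reducible] def cartierZariski (φ : CartierMap p e A) : TopologicalSpace (PrimeSpectrum A) :=
  TopologicalSpace.ofClosed
    {Z | ∃ I : Ideal A, φ.IsCompatible I ∧ Z = PrimeSpectrum.zeroLocus (I : Set A)}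
    ⟨⊤, fun _ _ => Submodule.mem_top, by simp⟩
    (by
      intro C hC
      choose f hf using fun Z : C => hC Z.2
      refine ⟨⨆ Z, f Z, φ.isCompatible_iSup f fun Z => (hf Z).1, ?_⟩
      rw [Set.sInter_eq_iInter, PrimeSpectrum.zeroLocus_iSup]
      exact Set.iInter_congr fun Z => (hf Z).2)
    (by
      rintro _ ⟨I, hI, rfl⟩ _ ⟨J, hJ, rfl⟩
      exact ⟨I ⊓ J, fun a ha => ⟨hI a ha.1, hJ a ha.2⟩,
        (PrimeSpectrum.zeroLocus_inf I J).symm⟩)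

end CartierMap

/-! ### Transposition of ideals, tame ramification, fibered transpositions -/

section Transposition

variable {R S : Type*} [CommRing R] [CommRing S] [Algebra R S]

/-- The `T`-transpose `𝔞 ^ T = {s | T (s S) ⊆ 𝔞}`. -/
def transposeIdeal (T : S →ₗ[R] R) (I : Ideal R) : Ideal S where
  carrier := {s | ∀ x, T (s * x) ∈ I}
  zero_mem' := by intro x; simp
  add_mem' := by
    intro a b ha hb x
    rw [add_mul, map_add]
    exact I.add_mem (ha x) (hb x)
  smul_mem' := by
    intro c a ha x
    have h : c • a * x = a * (c * x) := by simp only [smul_eq_mul]; ring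
    rw [h]
    exact ha _

/-- `S/R` is tamely `T`-ramified over `P` if `P ^ T = √(P S)`. -/
def IsTamelyRamified (T : S →ₗ[R] R) (P : PrimeSpectrum R) : Prop :=
  transposeIdeal T P.asIdeal = (P.asIdeal.map (algebraMap R S)).radical

variable (S) in
/-- The fiber of `Spec S → Spec R` over `P`, as a subset of `Spec S`. -/
def fiberSet (P : PrimeSpectrum R) : Set (PrimeSpectrum S) :=
  PrimeSpectrum.comap (algebraMap R S) ⁻¹' {P}

variable (S) in
/-- The coordinate ring `(S ⊗ κ(P))_red` of the reduced fiber over `P`. -/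
abbrev ReducedFiber (P : PrimeSpectrum R) : Type _ :=
  (P.asIdeal.Fiber S) ⧸ nilradical (P.asIdeal.Fiber S)

variable (S) in
/-- The canonical homomorphism `S → (S ⊗ κ(P))_red`. -/
def toReducedFiber (P : PrimeSpectrum R) : S →+* ReducedFiber S P :=
  (Ideal.Quotient.mk (nilradical (P.asIdeal.Fiber S))).comp
    (Algebra.TensorProduct.includeRight : S →ₐ[R] P.asIdeal.Fiber S).toRingHom

variable {p e : ℕ}

/-- A transposition of Cartier pairs `(R, φ) → (S, ψ)` along `T`: the map `T` is non-degenerate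
(its image contains a nonzerodivisor) and `T ∘ ψ = φ ∘ F^e_* T`. -/
structure IsTransposition (T : S →ₗ[R] R) (φ : CartierMap p e R) (ψ : CartierMap p e S) :
    Prop where
  nondegenerate : ∃ s, T s ∈ nonZeroDivisors R
  comm : ∀ s, T (ψ s) = φ (T s)

/-- A fibered transposition `(R, φ) → (S, ψ)` along `T`. -/
structure IsFibered (T : S →ₗ[R] R) (φ : CartierMap p e R) (ψ : CartierMap p e S) :
    Prop extends IsTransposition T φ ψ where
  /-- `Spec S → Spec R` is continuous for the Cartier-Zariski topologies. -/
  continuous_comap :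
    @Continuous _ _ ψ.cartierZariski φ.cartierZariski (PrimeSpectrum.comap (algebraMap R S))
  isRadical : ∀ P ∈ φ.CSpec, (transposeIdeal T P.asIdeal).IsRadical
  /-- Over each prime `φ`-ideal `P`, there are induced maps `φP`, `ψP`, `TP` on the residue field
  and on the reduced fiber; they commute; `ψP` is `F`-pure if `φP ≠ 0`, and zero if `φP = 0`. -/
  fiber : ∀ P ∈ φ.CSpec,
    ∃ (φP : CartierMap p e P.asIdeal.ResidueField) (ψP : CartierMap p e (ReducedFiber S P))
      (TP : ReducedFiber S P →ₗ[P.asIdeal.ResidueField] P.asIdeal.ResidueField),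
      CartierMap.IsHom (algebraMap R P.asIdeal.ResidueField) φ φP ∧
      CartierMap.IsHom (toReducedFiber S P) ψ ψP ∧
      (∀ s, TP (toReducedFiber S P s) = algebraMap R P.asIdeal.ResidueField (T s)) ∧
      (∀ x, TP (ψP x) = φP (TP x)) ∧
      ((∃ x, φP x ≠ 0) → ψP.IsFPure) ∧
      ((∀ x, φP x = 0) → ∀ x, ψP x = 0)

end Transposition

/-! ### Weil divisors on a normal noetherian domain -/

section WeilDivisors

open WithZero

/-- The prime divisors on `Spec R`: the primes of height one. -/
def PrimeDivisor (R : Type*) [CommRing R] : Type _ :=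
  {P : PrimeSpectrum R // P.asIdeal.height = 1}

variable {R : Type*} [CommRing R] [IsDomain R] [IsNoetherianRing R] [IsIntegrallyClosed R]

instance PrimeDivisor.isDiscreteValuationRing (P : PrimeDivisor R) :
    IsDiscreteValuationRing (Localization.AtPrime P.1.asIdeal) := by
  have hdim := IsLocalization.AtPrime.ringKrullDim_eq_height P.1.asIdeal
    (Localization.AtPrime P.1.asIdeal)
  rw [P.2] at hdim
  have hfield : ¬ IsField (Localization.AtPrime P.1.asIdeal) := by
    intro h
    rw [ringKrullDim_eq_zero_of_isField h] at hdim
    exact absurd hdim (by decide)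
  have hnoeth : IsNoetherianRing (Localization.AtPrime P.1.asIdeal) :=
    IsLocalization.isNoetherianRing P.1.asIdeal.primeCompl _ inferInstance
  have hic : IsIntegrallyClosed (Localization.AtPrime P.1.asIdeal) :=
    isIntegrallyClosed_of_isLocalization _ P.1.asIdeal.primeCompl
      P.1.asIdeal.primeCompl_le_nonZeroDivisors
  have hone : Ring.KrullDimLE 1 (Localization.AtPrime P.1.asIdeal) :=
    Ring.krullDimLE_iff.2 hdim.le
  have hmax := (Ring.krullDimLE_one_iff_of_isPrime_bot
    (R := Localization.AtPrime P.1.asIdeal)).1 hone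
  have htfae : IsDiscreteValuationRing (Localization.AtPrime P.1.asIdeal) ↔
      IsIntegrallyClosed (Localization.AtPrime P.1.asIdeal) ∧
        ∃! Q : Ideal (Localization.AtPrime P.1.asIdeal), Q ≠ ⊥ ∧ Q.IsPrime :=
    (IsDiscreteValuationRing.TFAE (Localization.AtPrime P.1.asIdeal) hfield).out 0 3
  refine htfae.2 ⟨hic, IsLocalRing.maximalIdeal _, ⟨?_, inferInstance⟩, ?_⟩
  · exact fun h => hfield (IsLocalRing.isField_iff_maximalIdeal_eq.2 h)
  · exact fun Q hQ => IsLocalRing.eq_maximalIdeal (hmax Q hQ.1 hQ.2)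

/-- The (multiplicatively written) discrete valuation of `Frac R` attached to a prime
divisor `P`: the valuation of the discrete valuation ring `R_P`. -/
def PrimeDivisor.valuation (P : PrimeDivisor R) : Valuation (FractionRing R) ℤᵐ⁰ :=
  (IsDiscreteValuationRing.maximalIdeal (Localization.AtPrime P.1.asIdeal)).valuation
    (FractionRing R)

/-- The order of vanishing of `f` along `P`. -/
def PrimeDivisor.ord (P : PrimeDivisor R) (f : (FractionRing R)ˣ) : ℤ :=
  -log (P.valuation (f : FractionRing R))

theorem PrimeDivisor.ord_mul (P : PrimeDivisor R) (f g : (FractionRing R)ˣ) :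
    P.ord (f * g) = P.ord f + P.ord g := by
  have hf : P.valuation (f : FractionRing R) ≠ 0 := (Valuation.ne_zero_iff _).2 f.ne_zero
  have hg : P.valuation (g : FractionRing R) ≠ 0 := (Valuation.ne_zero_iff _).2 g.ne_zero
  simp only [PrimeDivisor.ord, Units.val_mul, map_mul, log_mul hf hg]
  ring

variable (R) in
/-- Weil divisors on `Spec R`. -/
abbrev WeilDivisor : Type _ := PrimeDivisor R →₀ ℤ

variable (R) in
/-- The subgroup of principal divisors `div f`, with `f` a nonzero element of `Frac R`. -/
def principalDivisors : AddSubgroup (WeilDivisor R) where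
  carrier := {D | ∃ f : (FractionRing R)ˣ, ∀ P, D P = P.ord f}
  zero_mem' := ⟨1, fun P => by simp [PrimeDivisor.ord]⟩
  add_mem' := by
    rintro D D' ⟨f, hf⟩ ⟨g, hg⟩
    exact ⟨f * g, fun P => by rw [Finsupp.add_apply, hf, hg, P.ord_mul]⟩
  neg_mem' := by
    rintro D ⟨f, hf⟩
    refine ⟨f⁻¹, fun P => ?_⟩
    have h := P.ord_mul f f⁻¹
    rw [mul_inv_cancel, show P.ord 1 = 0 by simp [PrimeDivisor.ord]] at h
    rw [Finsupp.neg_apply, hf]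
    linarith

variable (R) in
/-- The divisor class group `Cl R`. -/
abbrev DivisorClassGroup : Type _ := WeilDivisor R ⧸ principalDivisors R

/-- The module `R(D) = {f | f = 0 or div f + D ≥ 0}`; the condition at `P` is expressed as
`v_P(f) ≤ exp (D P)` in terms of the multiplicative valuation. -/
def WeilDivisor.sections (D : WeilDivisor R) : Submodule R (FractionRing R) where
  carrier := {f | ∀ P : PrimeDivisor R, P.valuation f ≤ exp (D P)}
  zero_mem' := fun P => by simp
  add_mem' := fun ha hb P => (P.valuation.map_add _ _).trans (max_le (ha P) (hb P))
  smul_mem' := by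
    intro c f hf P
    have hc : P.valuation (algebraMap R (FractionRing R) c) ≤ 1 := by
      rw [IsScalarTower.algebraMap_apply R (Localization.AtPrime P.1.asIdeal) (FractionRing R)]
      exact IsDedekindDomain.HeightOneSpectrum.valuation_le_one _ _
    rw [Algebra.smul_def, map_mul]
    exact (mul_le_mul' hc (hf P)).trans (one_mul _).le

end WeilDivisors

/-! ### Covers graded by a finite abelian group -/

section GradedCovers

variable {R S Γ : Type*} [CommRing R] [CommRing S] [Algebra R S] [AddCommGroup Γ]
  [DecidableEq Γ]

/-- `R = S_0`: the structure map `R → S` is injective with image the degree-zero part. -/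
def IsDegreeZeroPart (𝒜 : Γ → Submodule R S) : Prop :=
  Function.Injective (algebraMap R S) ∧
    ∀ s, s ∈ 𝒜 0 ↔ s ∈ Set.range (algebraMap R S)

/-- The isomorphism of `R`-modules `R ≃ S_0`. -/
def degreeZeroEquiv (𝒜 : Γ → Submodule R S) (h : IsDegreeZeroPart 𝒜) : R ≃ₗ[R] 𝒜 0 :=
  LinearEquiv.ofBijective
    ((Algebra.linearMap R S).codRestrict (𝒜 0) fun r => (h.2 _).2 ⟨r, rfl⟩)
    ⟨fun _ _ hab => h.1 (congrArg Subtype.val hab), fun s => by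
      obtain ⟨r, hr⟩ := (h.2 _).1 s.2
      exact ⟨r, Subtype.ext hr⟩⟩

/-- The projection `𝔗 : S → S_0 = R` onto the degree-zero part. -/
def degreeZeroProj (𝒜 : Γ → Submodule R S) [GradedAlgebra 𝒜] (h : IsDegreeZeroPart 𝒜) :
    S →ₗ[R] R :=
  (degreeZeroEquiv 𝒜 h).symm.toLinearMap ∘ₗ
    (DirectSum.component R Γ (fun γ => 𝒜 γ) 0 ∘ₗ
      (DirectSum.decomposeLinearEquiv 𝒜).toLinearMap)

variable [IsDomain R] [IsNoetherianRing R] [IsIntegrallyClosed R]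

/-- A presentation of the graded algebra `S = ⨁ S_γ` over the normal domain `R` by divisors:
`S_γ = R(D_γ)` with `D_0 = 0`, the multiplication being
`R(D_γ) ⊗ R(D_γ') → R(D_γ + D_γ') → R(D_{γ+γ'})`, where the second map is multiplication by
`κ_{γ,γ'}` and is an isomorphism because `div κ_{γ,γ'} + D_{γ+γ'} = D_γ + D_γ'`. -/
structure DivisorialPresentation (𝒜 : Γ → Submodule R S) where
  D : Γ → WeilDivisor R
  D_zero : D 0 = 0
  iso : ∀ γ, 𝒜 γ ≃ₗ[R] (D γ).sections
  κ : Γ → Γ → (FractionRing R)ˣ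
  div_κ : ∀ γ γ' P, P.ord (κ γ γ') + D (γ + γ') P = D γ P + D γ' P
  mul_iso : ∀ (γ γ' : Γ) (a : 𝒜 γ) (b : 𝒜 γ') (c : 𝒜 (γ + γ')), (c : S) = a * b →
    (iso (γ + γ') c : FractionRing R) =
      (κ γ γ' : FractionRing R) * ((iso γ a : FractionRing R) * (iso γ' b : FractionRing R))

/-- The homomorphism `Γ → Cl R`, `γ ↦ [D_γ]`. -/
def DivisorialPresentation.toClassGroup {𝒜 : Γ → Submodule R S}
    (𝒟 : DivisorialPresentation 𝒜) : Γ →+ DivisorClassGroup R where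
  toFun γ := QuotientAddGroup.mk (𝒟.D γ)
  map_zero' := by rw [𝒟.D_zero]; rfl
  map_add' γ γ' := by
    rw [← QuotientAddGroup.mk_add]
    refine (QuotientAddGroup.eq).2 ⟨𝒟.κ γ γ', fun P => ?_⟩
    have h := 𝒟.div_κ γ γ' P
    simp only [Finsupp.add_apply, Finsupp.neg_apply]
    linarith

end GradedCovers

end

/-! Write T for `degreeZeroProj` and q = p^e. The pairing (s, t) ↦ T(st) is perfect. Linear forms on
R(D) are multiplications by elements of R(-D), because sections of R(D) attain the order prescribed
by D at each prime divisor, and S_{-γ} is a copy of R(-D_γ) twisted by κ. Hence ψ(s) must be, and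
can be, the element representing t ↦ φ(T(s t^q)): see `CartierMap.exists_forall_apply_eq` and
`CartierMap.eq_of_comm`.

Injectivity of Γ → Cl R forces S_γ S_{-γ} into the maximal ideal for γ ≠ 0, so s is a unit as soon
as T(s) is (`isUnit_of_degreeZeroProj_isUnit`). If φ(a) = 1, then T(ψ(a)) = 1, so ψ(a) is a unit and
ψ is surjective. For a surjective Cartier map, compatible ideals are radical and every compatible
prime is a center of F-purity. This removes the difference between `CSpec` and `Schpec` on both
sides.

For compatible P the ideal P^T is compatible, hence radical. It lies between PS and √(PS), because a
suitable power of each homogeneous component of s ∈ P^T is a value of T on sS. This is tameness, and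
fiberedness follows from it. Primes over P are minimal over P^T, so they are compatible.

The converse, that a compatible prime Q of S contracts to a compatible P, is the hard step: T need
not map Q into P when several primes lie over P. The remedy is the subalgebra B graded by the
p-primary torsion of Γ. It is ψ-stable and radicial over R, and there T(Q ∩ B) ⊆ P
(`apply_mem_of_pow_mem_range`). For a ∈ P one then has φ(a) = T(ψ(a)) ∈ P. -/

open WithZero TensorProduct

/-! ### Cartier maps: surjectivity, compatible ideals, descent to fractions -/

namespace CartierMap

variable {p e : ℕ} {A : Type*} [CommRing A]

theorem apply_zero (φ : CartierMap p e A) : φ 0 = 0 := φ.toAddMonoidHom.map_zero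

theorem apply_add (φ : CartierMap p e A) (a b : A) : φ (a + b) = φ a + φ b :=
  φ.toAddMonoidHom.map_add a b

theorem apply_sub (φ : CartierMap p e A) (a b : A) : φ (a - b) = φ a - φ b :=
  φ.toAddMonoidHom.map_sub a b

theorem apply_pow_mul (φ : CartierMap p e A) (a b : A) : φ (a ^ p ^ e * b) = a * φ b :=
  φ.map_pow_mul' a b

theorem pow_apply (φ : CartierMap p e A) (n : ℕ) (a : A) : φ.pow n a = φ^[n] a := rfl

@[ext]
theorem ext {φ ψ : CartierMap p e A} (h : ∀ a, φ a = ψ a) : φ = ψ := by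
  obtain ⟨f, hf⟩ := φ
  obtain ⟨g, hg⟩ := ψ
  obtain rfl : f = g := AddMonoidHom.ext h
  rfl

theorem IsCompatible.iterate {φ : CartierMap p e A} {I : Ideal A} (hI : φ.IsCompatible I)
    (n : ℕ) {a : A} (ha : a ∈ I) : φ^[n] a ∈ I := by
  induction n with
  | zero => exact ha
  | succ n ih => rw [Function.iterate_succ_apply']; exact hI _ ih

theorem surjective_of_apply_isUnit (φ : CartierMap p e A) {a : A} (h : IsUnit (φ a)) :
    Function.Surjective φ := by
  intro b
  obtain ⟨u, hu⟩ := h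
  refine ⟨(b * ↑u⁻¹) ^ p ^ e * a, ?_⟩
  rw [φ.apply_pow_mul, ← hu, mul_assoc, Units.inv_mul, mul_one]

theorem IsFPure.surjective [IsLocalRing A] {φ : CartierMap p e A} (h : φ.IsFPure) :
    Function.Surjective φ := by
  have hm : IsLocalRing.closedPoint A ∉ φ.nonFPureLocus := by
    rw [show φ.nonFPureLocus = ∅ from h]; exact Set.notMem_empty _
  have h1 : ¬ ∀ n : ℕ, 1 ≤ n →
      (1 : A) ∈ (φ.pow n).transposeIdeal (IsLocalRing.closedPoint A).asIdeal := by
    intro hall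
    apply hm
    change φ.core _ = ⊤
    rw [Ideal.eq_top_iff_one, core]
    simpa only [Submodule.mem_iInf] using hall
  push Not at h1
  obtain ⟨n, hn, hn1⟩ := h1
  obtain ⟨a, ha⟩ : ∃ a, IsUnit (φ.pow n a) := by
    by_contra! hall
    refine hn1 fun x => ?_
    exact (IsLocalRing.mem_maximalIdeal _).2 (hall _)
  -- F-purity only yields a unit value of some iterate; since n ≥ 1, that value is also a value of
  -- φ.
  obtain ⟨k, rfl⟩ : ∃ k, n = k + 1 := ⟨n - 1, by omega⟩
  rw [pow_apply, Function.iterate_succ_apply'] at ha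
  exact φ.surjective_of_apply_isUnit ha

theorem isFPure_of_surjective {φ : CartierMap p e A} (h : Function.Surjective φ) :
    φ.IsFPure := by
  refine Set.eq_empty_iff_forall_notMem.2 fun P hP => P.2.ne_top ?_
  have h1 : (1 : A) ∈ φ.core P.asIdeal := by
    rw [show φ.core P.asIdeal = ⊤ from hP]; exact Submodule.mem_top
  simp only [core, Submodule.mem_iInf] at h1
  obtain ⟨a, ha⟩ := h 1
  have h2 : φ.pow 1 (1 * a) ∈ P.asIdeal := h1 1 le_rfl a
  rw [pow_apply, Function.iterate_one, one_mul, ha] at h2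
  exact (Ideal.eq_top_iff_one _).2 h2

/-- If φ(c) = 1, then applying φ to a^(q^(n+1)) c lowers the exponent of a to q^n while staying
inside I. -/
theorem IsCompatible.isRadical {φ : CartierMap p e A} (h : Function.Surjective φ)
    (hp : 1 < p ^ e) {I : Ideal A} (hI : φ.IsCompatible I) : I.IsRadical := by
  have key : ∀ n : ℕ, ∀ a : A, a ^ (p ^ e) ^ n ∈ I → a ∈ I := by
    intro n
    induction n with
    | zero => intro a ha; simpa using ha
    | succ n ih =>
      intro a ha
      refine ih a ?_
      obtain ⟨c, hc⟩ := h 1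
      have h1 := hI _ (I.mul_mem_right c ha)
      rwa [_root_.pow_succ, pow_mul, φ.apply_pow_mul, hc, mul_one] at h1
  rintro a ⟨n, hn⟩
  exact key n a (I.pow_mem_of_pow_mem hn (Nat.lt_pow_self hp).le)

/-- Localized at Q, the radical ideal I becomes Q, so each a ∈ Q has some x ∉ Q with xa ∈ I. Then
xφ(a) = φ(x^q a) lies in I ⊆ Q. -/
theorem IsCompatible.of_mem_minimalPrimes {φ : CartierMap p e A} (hp : p ^ e ≠ 0)
    {I Q : Ideal A} (hI : φ.IsCompatible I) (hrad : I.IsRadical) (hQ : Q ∈ I.minimalPrimes) :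
    φ.IsCompatible Q := by
  intro a ha
  have := hQ.1.1
  obtain ⟨x, hx, hxa'⟩ : ∃ x ∉ Q, x * a ∈ I := by
    by_contra! hcon
    have hdisj : Disjoint (I : Set A) ↑(Q.primeCompl ⊔ Submonoid.powers a) := by
      refine Set.disjoint_left.2 fun y hy hy' => ?_
      obtain ⟨x, hx, _, ⟨n, rfl⟩, rfl⟩ := Submonoid.mem_sup.1 hy'
      refine hcon x hx (hrad ⟨n + 1, ?_⟩)
      rw [show (x * a) ^ (n + 1) = (x ^ n * a) * (x * a ^ n) by ring]
      exact I.mul_mem_left _ hy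
    obtain ⟨Q', hQ', hIQ', hd⟩ := Ideal.exists_le_prime_disjoint I _ hdisj
    have hle : Q' ≤ Q := fun y hy => by
      by_contra hyQ
      exact Set.disjoint_left.1 hd hy (Submonoid.mem_sup_left hyQ)
    exact Set.disjoint_left.1 hd (hQ.2 ⟨hQ', hIQ'⟩ hle ha)
      (Submonoid.mem_sup_right (Submonoid.mem_powers a))
  have h1 : x * φ a ∈ I := by
    rw [← φ.apply_pow_mul]
    refine hI _ ?_
    obtain ⟨k, hk⟩ := Nat.exists_eq_succ_of_ne_zero hp
    rw [hk, _root_.pow_succ, mul_assoc]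
    exact I.mul_mem_left _ hxa'
  exact ((hQ.1.1).mem_or_mem (hQ.1.2 h1)).resolve_left hx

/-- A Cartier map descends along a homomorphism which is the composition of a quotient by a
compatible ideal and a localization. -/
theorem exists_isHom_of_fractions {B : Type*} [CommRing B] (g : A →+* B)
    (φ : CartierMap p e A) (hp : p ^ e ≠ 0) (hker : φ.IsCompatible (RingHom.ker g))
    (M : Submonoid A) (hM : ∀ m ∈ M, IsUnit (g m))
    (hsurj : ∀ b, ∃ a, ∃ m ∈ M, b * g m = g a) :
    ∃ ψ : CartierMap p e B, IsHom g φ ψ := by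
  obtain ⟨k, hk⟩ := Nat.exists_eq_succ_of_ne_zero hp
  have hex : ∀ b, ∃ c, ∀ a, ∀ m ∈ M, b * g m = g a → c * g m = g (φ (m ^ k * a)) := by
    intro b
    obtain ⟨a, m, hm, hb⟩ := hsurj b
    obtain ⟨u, hu⟩ := hM m hm
    -- Here k = q - 1: writing b = a/m = m^k a / m^q makes the denominator a q-th power, which
    -- leaves φ as m.
    refine ⟨g (φ (m ^ k * a)) * ↑u⁻¹, fun a' m' hm' hb' => ?_⟩
    have h0 : m' * a - m * a' ∈ RingHom.ker g := by
      rw [RingHom.mem_ker, map_sub, map_mul, map_mul, ← hb, ← hb']; ring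
    have h1 := hker _ (Ideal.mul_mem_left _ (m' ^ k * m ^ k) h0)
    rw [show m' ^ k * m ^ k * (m' * a - m * a') =
      m' ^ p ^ e * (m ^ k * a) - m ^ p ^ e * (m' ^ k * a') by rw [hk, Nat.succ_eq_add_one]; ring,
      φ.apply_sub, φ.apply_pow_mul, φ.apply_pow_mul, RingHom.mem_ker, map_sub, map_mul,
      map_mul, sub_eq_zero] at h1
    refine (hM m hm).mul_left_cancel ?_
    rw [← h1, ← hu]
    linear_combination (g (φ (m ^ k * a)) * g m') * u.mul_inv
  choose f hf using hex
  have hadd : ∀ b b', f (b + b') = f b + f b' := by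
    intro b b'
    obtain ⟨a, m, hm, hb⟩ := hsurj b
    obtain ⟨a', m', hm', hb'⟩ := hsurj b'
    have h1 := hf b a m hm hb
    have h2 := hf b' a' m' hm' hb'
    have h3 := hf (b + b') (a * m' + a' * m) (m * m') (M.mul_mem hm hm') (by
      simp only [map_add, map_mul, ← hb, ← hb']; ring)
    rw [show (m * m') ^ k * (a * m' + a' * m) =
      m' ^ p ^ e * (m ^ k * a) + m ^ p ^ e * (m' ^ k * a') by rw [hk, Nat.succ_eq_add_one]; ring,
      φ.apply_add, φ.apply_pow_mul, φ.apply_pow_mul, map_add, map_mul g m', map_mul g m (φ _),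
      ← h1, ← h2] at h3
    refine (hM _ (M.mul_mem hm hm')).mul_right_cancel ?_
    rw [h3, map_mul]; ring
  refine ⟨{ toFun := f, map_zero' := ?_, map_add' := hadd, map_pow_mul' := ?_ }, ?_⟩
  · have := hadd 0 0
    rwa [add_zero, left_eq_add] at this
  · intro b b'
    obtain ⟨a, m, hm, hb⟩ := hsurj b
    obtain ⟨a', m', hm', hb'⟩ := hsurj b'
    have h2 := hf b' a' m' hm' hb'
    have hmem : m ^ p ^ e * m' ∈ M := M.mul_mem (M.pow_mem hm _) hm'
    have h3 := hf (b ^ p ^ e * b') (a ^ p ^ e * a') (m ^ p ^ e * m') hmem (by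
      simp only [map_mul, map_pow, ← hb, ← hb', mul_pow]; ring)
    rw [show (m ^ p ^ e * m') ^ k * (a ^ p ^ e * a') =
      (m ^ k * a) ^ p ^ e * (m' ^ k * a') by ring, φ.apply_pow_mul, map_mul g (_ * a),
      ← h2, map_mul g _ a, ← hb] at h3
    refine (hM _ hmem).mul_right_cancel ?_
    rw [show f (b ^ p ^ e * b') * g (m ^ p ^ e * m') = _ from h3, map_mul, map_pow, map_pow, hk,
      Nat.succ_eq_add_one]
    ring
  · intro a
    have := hf (g a) a 1 M.one_mem (by simp)
    simpa using this

theorem exists_isHom_residueField (φ : CartierMap p e A) (hp : p ^ e ≠ 0)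
    {P : PrimeSpectrum A} (hP : P ∈ φ.CSpec) :
    ∃ φP : CartierMap p e P.asIdeal.ResidueField,
      IsHom (algebraMap A P.asIdeal.ResidueField) φ φP := by
  refine φ.exists_isHom_of_fractions _ hp ?_ P.asIdeal.primeCompl ?_ ?_
  · rw [Ideal.ker_algebraMap_residueField]; exact hP
  · intro m hm
    rw [isUnit_iff_ne_zero, Ne, Ideal.algebraMap_residueField_eq_zero]
    exact hm
  · intro b
    obtain ⟨x, y, hy, rfl⟩ := IsFractionRing.div_surjective (A ⧸ P.asIdeal) b
    obtain ⟨a, rfl⟩ := Ideal.Quotient.mk_surjective x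
    obtain ⟨m, rfl⟩ := Ideal.Quotient.mk_surjective y
    have hm : algebraMap A P.asIdeal.ResidueField m ≠ 0 := by
      rw [← Ideal.algebraMap_quotient_residueField_mk]
      exact IsFractionRing.to_map_ne_zero_of_mem_nonZeroDivisors hy
    refine ⟨a, m, ?_, ?_⟩
    · rwa [Ne, Ideal.algebraMap_residueField_eq_zero] at hm
    · rw [Ideal.algebraMap_quotient_residueField_mk, Ideal.algebraMap_quotient_residueField_mk,
        div_mul_cancel₀ _ hm]

theorem CSpec_subset_Schpec {φ : CartierMap p e A} (h : Function.Surjective φ)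
    (hp : p ^ e ≠ 0) : φ.CSpec ⊆ φ.Schpec := by
  intro P hP
  obtain ⟨φP, hφP⟩ := φ.exists_isHom_residueField hp hP
  obtain ⟨c, hc⟩ := h 1
  refine ⟨hP, φP, hφP, algebraMap A _ c, ?_⟩
  rw [hφP c, hc, map_one]
  exact one_ne_zero

end CartierMap

/-! ### Orders along prime divisors and duality for divisorial modules -/

section Divisors

variable {R : Type*} [CommRing R]

theorem WeilDivisor.exists_natAbs_le (D : WeilDivisor R) : ∃ n : ℕ, ∀ P, -(n : ℤ) ≤ D P := by
  refine ⟨∑ P ∈ D.support, (D P).natAbs, fun P => ?_⟩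
  by_cases hP : P ∈ D.support
  · have := Finset.single_le_sum (f := fun P => (D P).natAbs) (fun _ _ => Nat.zero_le _) hP
    omega
  · rw [Finsupp.notMem_support_iff.1 hP]
    omega

namespace PrimeDivisor

theorem not_le_of_ne [IsNoetherianRing R] {P Q : PrimeDivisor R} (h : Q ≠ P) : ¬ Q.1.asIdeal ≤ P.1.asIdeal := by
  intro hle
  have hlt : Q.1.asIdeal < P.1.asIdeal :=
    lt_of_le_of_ne hle fun h' => h (Subtype.ext (PrimeSpectrum.ext h'))
  have := Ideal.height_strict_mono_of_isPrime hlt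
  rw [P.2, Q.2] at this
  exact lt_irrefl _ this

variable [IsDomain R]

theorem ne_bot (P : PrimeDivisor R) : P.1.asIdeal ≠ ⊥ := by
  intro h
  have := P.2
  rw [h, Ideal.height_bot] at this
  exact zero_ne_one this

theorem algebraMap_eq (P : PrimeDivisor R) (a : R) :
    algebraMap R (FractionRing R) a =
      algebraMap (Localization.AtPrime P.1.asIdeal) (FractionRing R)
        (algebraMap R (Localization.AtPrime P.1.asIdeal) a) :=
  IsScalarTower.algebraMap_apply _ _ _ _

variable [IsNoetherianRing R]

/-- Height-one primes containing b are minimal over (b), and a noetherian ring has finitely many of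
those. -/
theorem finite_setOf_mem {b : R} (hb : b ≠ 0) :
    {P : PrimeDivisor R | b ∈ P.1.asIdeal}.Finite := by
  refine Set.Finite.of_finite_image (f := fun P => P.1.asIdeal)
    ((Ideal.finite_minimalPrimes_of_isNoetherianRing R (Ideal.span {b})).subset ?_) ?_
  · rintro _ ⟨P, hP, rfl⟩
    refine ⟨⟨P.1.2, (Ideal.span_singleton_le_iff_mem _).2 hP⟩, fun J ⟨hJ, hbJ⟩ hJP => ?_⟩
    by_contra hPJ
    have hlt := Ideal.height_strict_mono_of_isPrime (lt_of_le_not_ge hJP hPJ)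
    rw [P.2, Order.lt_one_iff, Ideal.height_eq_zero_iff, IsDomain.minimalPrimes_eq_singleton_bot,
      Set.mem_singleton_iff] at hlt
    exact hb ((Submodule.mem_bot R).1 (hlt ▸ hbJ (Ideal.mem_span_singleton_self b)))
  · intro P _ Q _ h
    exact Subtype.ext (PrimeSpectrum.ext h)

variable [IsIntegrallyClosed R]

theorem valuation_algebraMap_le_one (P : PrimeDivisor R) (a : R) :
    P.valuation (algebraMap R (FractionRing R) a) ≤ 1 := by
  rw [P.algebraMap_eq]
  exact IsDedekindDomain.HeightOneSpectrum.valuation_le_one _ _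

theorem valuation_algebraMap_lt_one_iff (P : PrimeDivisor R) (a : R) :
    P.valuation (algebraMap R (FractionRing R) a) < 1 ↔ a ∈ P.1.asIdeal := by
  rw [P.algebraMap_eq, ← IsLocalization.AtPrime.to_map_mem_maximal_iff
    (Localization.AtPrime P.1.asIdeal) P.1.asIdeal]
  exact IsDedekindDomain.HeightOneSpectrum.valuation_lt_one_iff_mem _ _

theorem valuation_algebraMap_eq_one (P : PrimeDivisor R) {a : R} (ha : a ∉ P.1.asIdeal) :
    P.valuation (algebraMap R (FractionRing R) a) = 1 :=
  (P.valuation_algebraMap_le_one a).eq_of_not_lt fun h =>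
    ha ((P.valuation_algebraMap_lt_one_iff a).1 h)

theorem valuation_algebraMap_le_exp (P : PrimeDivisor R) {a : R} (ha : a ∈ P.1.asIdeal) :
    P.valuation (algebraMap R (FractionRing R) a) ≤ exp (-1) := by
  have h := (P.valuation_algebraMap_lt_one_iff a).2 ha
  by_cases h0 : P.valuation (algebraMap R (FractionRing R) a) = 0
  · rw [h0]; exact zero_le
  · rw [← exp_log h0] at h ⊢
    rw [← exp_zero, exp_lt_exp] at h
    rw [exp_le_exp]
    omega

theorem exists_valuation_eq (P : PrimeDivisor R) (n : ℤ) :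
    ∃ g : FractionRing R, P.valuation g = exp n := by
  obtain ⟨π, hπ⟩ := (IsDiscreteValuationRing.maximalIdeal
    (Localization.AtPrime P.1.asIdeal)).valuation_exists_uniformizer (FractionRing R)
  refine ⟨π ^ (-n), ?_⟩
  rw [map_zpow₀, show P.valuation π = exp (-1) from hπ, ← exp_zsmul]
  simp

/-- Take the product of n-th powers of elements of Q outside J. With J = 0 this produces nonzero
sections; with J a prime divisor it clears poles elsewhere without changing the order at J. -/
theorem exists_notMem_valuation_le (J : Ideal R) [J.IsPrime] (s : Finset (PrimeDivisor R))
    (hs : ∀ Q ∈ s, ¬ Q.1.asIdeal ≤ J) (n : ℕ) :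
    ∃ a ∉ J, ∀ Q ∈ s, Q.valuation (algebraMap R (FractionRing R) a) ≤ exp (-(n : ℤ)) := by
  classical
  have hex : ∀ Q : PrimeDivisor R, ∃ b, Q ∈ s → b ∈ Q.1.asIdeal ∧ b ∉ J := by
    intro Q
    by_cases hQ : Q ∈ s
    · obtain ⟨b, hb⟩ := Set.not_subset.1 (hs Q hQ)
      exact ⟨b, fun _ => hb⟩
    · exact ⟨0, fun h => absurd h hQ⟩
  choose b hb using hex
  refine ⟨∏ Q ∈ s, b Q ^ n, ?_, fun Q hQ => ?_⟩
  · intro h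
    obtain ⟨Q, hQ, h⟩ := (Ideal.IsPrime.prod_mem_iff).1 h
    exact (hb Q hQ).2 (Ideal.IsPrime.mem_of_pow_mem ‹_› n h)
  · rw [← Finset.mul_prod_erase s _ hQ, map_mul, map_mul, map_pow, map_pow]
    calc _ ≤ exp (-1) ^ n * (1 : ℤᵐ⁰) :=
          mul_le_mul' (pow_le_pow_left' (Q.valuation_algebraMap_le_exp (hb Q hQ).1) n)
            (Q.valuation_algebraMap_le_one _)
      _ = _ := by rw [mul_one, ← exp_nsmul]; simp

end PrimeDivisor

namespace WeilDivisor

variable [IsDomain R] [IsNoetherianRing R] [IsIntegrallyClosed R]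

theorem exists_ne_zero_mem_sections (D : WeilDivisor R) : ∃ f ∈ D.sections, f ≠ 0 := by
  obtain ⟨n, hn⟩ := D.exists_natAbs_le
  obtain ⟨a, ha, h⟩ := PrimeDivisor.exists_notMem_valuation_le (⊥ : Ideal R) D.support
    (fun Q _ h => Q.ne_bot (le_bot_iff.1 h)) n
  refine ⟨algebraMap R _ a, fun P => ?_, ?_⟩
  · by_cases hP : P ∈ D.support
    · exact (h P hP).trans (exp_le_exp.2 (hn P))
    · rw [Finsupp.notMem_support_iff.1 hP, exp_zero]
      exact P.valuation_algebraMap_le_one a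
  · exact (FaithfulSMul.algebraMap_eq_zero_iff _ _).not.2 ha

/-- A divisorial module attains the prescribed order along each prime divisor. -/
theorem exists_mem_sections_valuation_eq (D : WeilDivisor R) (P : PrimeDivisor R) :
    ∃ f ∈ D.sections, P.valuation f = exp (D P) := by
  classical
  obtain ⟨g, hg⟩ := P.exists_valuation_eq (D P)
  obtain ⟨x, y, hy, rfl⟩ := IsFractionRing.div_surjective R g
  have hy0 : y ≠ 0 := nonZeroDivisors.ne_zero hy
  obtain ⟨n, hn⟩ := D.exists_natAbs_le
  have hfin := PrimeDivisor.finite_setOf_mem hy0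
  have hmap0 : algebraMap R (FractionRing R) y ≠ 0 :=
    (FaithfulSMul.algebraMap_eq_zero_iff _ _).not.2 hy0
  obtain ⟨m, hm⟩ : ∃ m : ℕ, ∀ Q ∈ hfin.toFinset,
      -(m : ℤ) ≤ log (Q.valuation (algebraMap R (FractionRing R) y)) := by
    refine ⟨∑ Q ∈ hfin.toFinset,
      (log (Q.valuation (algebraMap R (FractionRing R) y))).natAbs, fun Q hQ => ?_⟩
    have := Finset.single_le_sum (f := fun Q : PrimeDivisor R =>
      (log (Q.valuation (algebraMap R (FractionRing R) y))).natAbs) (fun _ _ => Nat.zero_le _) hQ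
    omega
  -- The fraction x/y has the right order at P but may violate the bound at other divisors in the
  -- support of D or containing y. The factor a is invertible at P and vanishes there to order n +
  -- m, where n bounds D from below and m bounds the order of y.
  obtain ⟨a, ha, h⟩ := PrimeDivisor.exists_notMem_valuation_le P.1.asIdeal
    ((D.support ∪ hfin.toFinset).erase P)
    (fun Q hQ => PrimeDivisor.not_le_of_ne (Finset.ne_of_mem_erase hQ)) (n + m)
  refine ⟨algebraMap R _ a * (algebraMap R _ x / algebraMap R _ y), fun Q => ?_, ?_⟩
  · by_cases hQP : Q = P
    · subst hQP
      rw [map_mul, Q.valuation_algebraMap_eq_one ha, one_mul, hg]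
    · have hQy : Q.valuation (algebraMap R (FractionRing R) y) ≠ 0 :=
        (Valuation.ne_zero_iff _).2 hmap0
      rw [map_mul, map_div₀, mul_div_assoc', div_le_iff₀ (zero_lt_iff.2 hQy)]
      refine (mul_le_of_le_one_right' (Q.valuation_algebraMap_le_one x)).trans ?_
      by_cases hQ : Q ∈ D.support ∪ hfin.toFinset
      · refine (h Q (Finset.mem_erase.2 ⟨hQP, hQ⟩)).trans ?_
        rw [← exp_log hQy, ← exp_add, exp_le_exp]
        have h1 := hn Q
        by_cases hQ' : Q ∈ hfin.toFinset
        · have h2 := hm Q hQ'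
          push_cast
          linarith
        · rw [Q.valuation_algebraMap_eq_one (by simpa using hQ'), log_one]
          push_cast
          linarith
      · rw [Finset.mem_union, not_or] at hQ
        rw [Finsupp.notMem_support_iff.1 hQ.1, exp_zero, one_mul,
          Q.valuation_algebraMap_eq_one (a := y) (by simpa using hQ.2)]
        exact Q.valuation_algebraMap_le_one a
  · rw [map_mul, P.valuation_algebraMap_eq_one ha, one_mul, hg]

/-- Every `R`-linear form on `R(D)` is multiplication by an element of `R(-D)`. -/
theorem exists_eq_mul_of_linearMap (D : WeilDivisor R) (l : D.sections →ₗ[R] R) :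
    ∃ c : FractionRing R, (∀ P : PrimeDivisor R, P.valuation c ≤ exp (-D P)) ∧
      ∀ f : D.sections, algebraMap R (FractionRing R) (l f) = c * f := by
  obtain ⟨f₀, hf₀, h0⟩ := D.exists_ne_zero_mem_sections
  -- R(D) has rank one, so l is determined by its value at the nonzero section f₀.
  have hc : ∀ f : D.sections, algebraMap R (FractionRing R) (l f) =
      algebraMap R (FractionRing R) (l ⟨f₀, hf₀⟩) / f₀ * f := by
    intro f
    obtain ⟨a, b, hb, hab⟩ := IsFractionRing.div_surjective R ((f : FractionRing R) / f₀)
    have hb0 : algebraMap R (FractionRing R) b ≠ 0 :=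
      IsFractionRing.to_map_ne_zero_of_mem_nonZeroDivisors hb
    have hK : algebraMap R (FractionRing R) b * f = algebraMap R (FractionRing R) a * f₀ := by
      field_simp at hab
      linear_combination -hab
    have hlin : b • f = a • (⟨f₀, hf₀⟩ : D.sections) := by
      ext
      simpa [Algebra.smul_def] using hK
    have h1 := congrArg (fun x => algebraMap R (FractionRing R) (l x)) hlin
    simp only [map_smul, smul_eq_mul, map_mul] at h1
    refine mul_left_cancel₀ hb0 ?_
    rw [h1]
    field_simp
    linear_combination -(algebraMap R (FractionRing R) (l ⟨f₀, hf₀⟩)) * hK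
  refine ⟨_, fun P => ?_, hc⟩
  -- A section of exact order at P makes the bound on c sharp: integrality of cf there gives the
  -- bound -D P.
  obtain ⟨f, hf, hfP⟩ := D.exists_mem_sections_valuation_eq P
  have h1 := P.valuation_algebraMap_le_one (l ⟨f, hf⟩)
  rw [hc, map_mul, hfP] at h1
  rw [exp_neg, ← one_mul (_)⁻¹]
  exact (le_mul_inv_iff₀ exp_pos).2 h1

end WeilDivisor

end Divisors

/-! ### Transposes along a perfect trace form -/

section Transposition

variable {R S : Type*} [CommRing R] [CommRing S] [Algebra R S] {p e : ℕ}
  {T : S →ₗ[R] R}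

theorem apply_algebraMap_mul (T : S →ₗ[R] R) (r : R) (s : S) :
    T (algebraMap R S r * s) = r * T s := by
  rw [← Algebra.smul_def, map_smul, smul_eq_mul]

theorem map_le_transposeIdeal (T : S →ₗ[R] R) (I : Ideal R) :
    I.map (algebraMap R S) ≤ transposeIdeal T I := by
  rw [Ideal.map_le_iff_le_comap]
  intro r hr x
  rw [apply_algebraMap_mul]
  exact I.mul_mem_right _ hr

theorem mem_of_mem_transposeIdeal {I : Ideal R} {s : S} (hs : s ∈ transposeIdeal T I) :
    T s ∈ I := by
  simpa using hs 1

theorem mem_transposeIdeal_of_algebraMap_mul_mem {P : Ideal R} [P.IsPrime] {r : R} (hr : r ∉ P)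
    {s : S} (h : algebraMap R S r * s ∈ transposeIdeal T P) : s ∈ transposeIdeal T P := by
  intro x
  have := h x
  rw [mul_assoc, apply_algebraMap_mul] at this
  exact (Ideal.IsPrime.mem_or_mem ‹_› this).resolve_left hr

theorem apply_mul_eq_of_comm {φ : CartierMap p e R} {ψ : CartierMap p e S}
    (h : ∀ s, T (ψ s) = φ (T s)) (t s : S) : T (t * ψ s) = φ (T (t ^ p ^ e * s)) := by
  rw [← ψ.apply_pow_mul, h]

theorem transposeIdeal_isCompatible {φ : CartierMap p e R} {ψ : CartierMap p e S}
    (h : ∀ s, T (ψ s) = φ (T s)) {I : Ideal R} (hI : φ.IsCompatible I) :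
    ψ.IsCompatible (transposeIdeal T I) := by
  intro s hs x
  rw [mul_comm, apply_mul_eq_of_comm h, mul_comm]
  exact hI _ (hs _)

theorem CartierMap.eq_of_comm (hT : ∀ s, (∀ t, T (s * t) = 0) → s = 0) {φ : CartierMap p e R}
    {ψ ψ' : CartierMap p e S} (h : ∀ s, T (ψ s) = φ (T s)) (h' : ∀ s, T (ψ' s) = φ (T s)) :
    ψ' = ψ := by
  ext s
  refine sub_eq_zero.1 (hT _ fun t => ?_)
  rw [mul_comm, mul_sub, map_sub, apply_mul_eq_of_comm h, apply_mul_eq_of_comm h', sub_self]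

/-- The form t ↦ φ(T(s t^q)) is R-linear, and ψ(s) is the element representing it. Nondegeneracy
makes this choice additive and q-linear; t = 1 gives commutation with T. -/
theorem CartierMap.exists_forall_apply_eq [Fact p.Prime] [CharP S p] (hT : ∀ s, (∀ t, T (s * t) = 0) → s = 0)
    (hdual : ∀ l : S →ₗ[R] R, ∃ s, ∀ t, T (s * t) = l t) (φ : CartierMap p e R) :
    ∃ ψ : CartierMap p e S, ∀ s, T (ψ s) = φ (T s) := by
  let l : S → S →ₗ[R] R := fun s =>
    { toFun := fun t => φ (T (s * t ^ p ^ e))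
      map_add' := fun t t' => by
        rw [add_pow_char_pow, mul_add, map_add, φ.apply_add]
      map_smul' := fun r t => by
        rw [smul_pow, mul_smul_comm, map_smul, smul_eq_mul, φ.apply_pow_mul]
        rfl }
  choose f hf using fun s => hdual (l s)
  have hf' : ∀ s t, T (f s * t) = φ (T (s * t ^ p ^ e)) := hf
  have ext : ∀ a b : S, (∀ t, T (a * t) = T (b * t)) → a = b := fun a b h =>
    sub_eq_zero.1 (hT _ fun t => by rw [sub_mul, map_sub, h, sub_self])
  refine ⟨{ toFun := f, map_zero' := ?_, map_add' := ?_, map_pow_mul' := ?_ }, fun s => ?_⟩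
  · refine ext _ _ fun t => ?_
    rw [hf', zero_mul, zero_mul, map_zero, φ.apply_zero]
  · intro a b
    refine ext _ _ fun t => ?_
    rw [hf', add_mul, map_add, φ.apply_add, add_mul, map_add, hf', hf']
  · intro a b
    refine ext _ _ fun t => ?_
    rw [hf' (a ^ p ^ e * b), mul_comm a, mul_assoc (f b), hf' b, mul_pow]
    congr 2
    ring
  · simpa using hf' s 1

end Transposition

/-! ### Graded covers: the perfect pairing and detection of units in degree zero -/

section Graded

variable {R S Γ : Type*} [CommRing R] [CommRing S] [Algebra R S] [AddCommGroup Γ]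
  [DecidableEq Γ] (𝒜 : Γ → Submodule R S) [GradedAlgebra 𝒜] (h : IsDegreeZeroPart 𝒜)

theorem algebraMap_degreeZeroProj (s : S) :
    algebraMap R S (degreeZeroProj 𝒜 h s) = DirectSum.decompose 𝒜 s 0 :=
  congrArg Subtype.val ((degreeZeroEquiv 𝒜 h).apply_symm_apply (DirectSum.decompose 𝒜 s 0))

theorem degreeZeroProj_algebraMap (r : R) : degreeZeroProj 𝒜 h (algebraMap R S r) = r := by
  apply h.1
  rw [algebraMap_degreeZeroProj, DirectSum.decompose_of_mem_same]
  exact (h.2 _).2 ⟨r, rfl⟩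

theorem degreeZeroProj_one : degreeZeroProj 𝒜 h 1 = 1 := by
  simpa using degreeZeroProj_algebraMap 𝒜 h 1

theorem algebraMap_degreeZeroProj_of_mem {s : S} (hs : s ∈ 𝒜 0) :
    algebraMap R S (degreeZeroProj 𝒜 h s) = s := by
  rw [algebraMap_degreeZeroProj, DirectSum.decompose_of_mem_same _ hs]

theorem degreeZeroProj_of_mem_ne {γ : Γ} (hγ : γ ≠ 0) {s : S} (hs : s ∈ 𝒜 γ) :
    degreeZeroProj 𝒜 h s = 0 := by
  apply h.1
  rw [algebraMap_degreeZeroProj, DirectSum.decompose_of_mem_ne _ hs hγ, map_zero]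

theorem algebraMap_degreeZeroProj_mul (s : S) {γ δ : Γ} (hγδ : γ + δ = 0) {t : S}
    (ht : t ∈ 𝒜 δ) :
    algebraMap R S (degreeZeroProj 𝒜 h (s * t)) = DirectSum.decompose 𝒜 s γ * t := by
  rw [algebraMap_degreeZeroProj, ← DirectSum.coe_decompose_mul_add_of_right_mem 𝒜 ht, hγδ]

/-- If γ has order n + 1, then s_γ^(n+1) is the degree-zero part of s · s_γ^n, hence a value of T on
sS. -/
theorem transposeIdeal_degreeZeroProj_le_radical [Finite Γ] (I : Ideal R) :
    transposeIdeal (degreeZeroProj 𝒜 h) I ≤ (I.map (algebraMap R S)).radical := by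
  classical
  intro s hs
  rw [← DirectSum.sum_support_decompose 𝒜 s]
  refine Ideal.sum_mem _ fun γ _ => ?_
  obtain ⟨n, hn⟩ := Nat.exists_eq_succ_of_ne_zero (addOrderOf_pos γ).ne'
  have hn0 : γ + n • γ = 0 := by
    rw [← succ_nsmul', ← Nat.succ_eq_add_one, ← hn, addOrderOf_nsmul_eq_zero]
  refine ⟨n + 1, ?_⟩
  rw [pow_succ', ← algebraMap_degreeZeroProj_mul 𝒜 h s hn0
    (SetLike.pow_mem_graded n (DirectSum.decompose 𝒜 s γ).2)]
  exact Ideal.mem_map_of_mem _ (hs _)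

variable [IsDomain R] [IsNoetherianRing R] [IsIntegrallyClosed R]

namespace DivisorialPresentation

variable {𝒜} (𝒟 : DivisorialPresentation 𝒜)

/-- The rational function corresponding to `1 ∈ S_0`. -/
def unitSection : FractionRing R := 𝒟.iso 0 ⟨1, SetLike.one_mem_graded 𝒜⟩

/-- The presentation need not send 1 ∈ S_0 to 1, so comparisons with the fraction field carry the
factor `unitSection`, which has valuation 1 at every prime divisor. -/
theorem iso_of_degree_eq_zero {δ : Γ} (hδ : δ = 0) (c : 𝒜 δ) :
    (𝒟.iso δ c : FractionRing R) =
      algebraMap R (FractionRing R) (degreeZeroProj 𝒜 h c) * 𝒟.unitSection := by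
  subst hδ
  have hc : c = degreeZeroProj 𝒜 h c • (⟨1, SetLike.one_mem_graded 𝒜⟩ : 𝒜 0) := by
    ext
    rw [Submodule.coe_smul, Algebra.smul_def, mul_one, algebraMap_degreeZeroProj_of_mem 𝒜 h c.2]
  conv_lhs => rw [hc, map_smul]
  rw [Submodule.coe_smul, Algebra.smul_def]
  rfl

include h in
theorem valuation_unitSection (P : PrimeDivisor R) : P.valuation 𝒟.unitSection = 1 := by
  refine le_antisymm ?_ ?_
  · have := (𝒟.iso 0 ⟨1, SetLike.one_mem_graded 𝒜⟩).2 P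
    refine this.trans_eq ?_
    rw [𝒟.D_zero, Finsupp.zero_apply, exp_zero]
  · have h1 : (1 : FractionRing R) ∈ (𝒟.D 0).sections := fun P => by
      rw [𝒟.D_zero, Finsupp.zero_apply, exp_zero, map_one]
    have h2 := 𝒟.iso_of_degree_eq_zero h rfl ((𝒟.iso 0).symm ⟨1, h1⟩)
    rw [LinearEquiv.apply_symm_apply] at h2
    have h3 := congrArg P.valuation h2
    rw [map_one, map_mul] at h3
    rw [h3]
    exact mul_le_of_le_one_left' (P.valuation_algebraMap_le_one _)

include h in
theorem unitSection_ne_zero : 𝒟.unitSection ≠ 0 := by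
  intro h0
  have h1 : (⟨1, SetLike.one_mem_graded 𝒜⟩ : 𝒜 0) = 0 :=
    (𝒟.iso 0).injective (Subtype.ext (by rw [map_zero]; exact h0))
  have h2 : (algebraMap R S) 1 = algebraMap R S 0 := by
    rw [map_one, map_zero]; exact congrArg Subtype.val h1
  exact one_ne_zero (h.1 h2)

theorem algebraMap_degreeZeroProj_mul_unitSection {γ δ : Γ} (hγδ : γ + δ = 0) (a : 𝒜 γ)
    (b : 𝒜 δ) :
    algebraMap R (FractionRing R) (degreeZeroProj 𝒜 h (a * b)) * 𝒟.unitSection =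
      𝒟.κ γ δ * (𝒟.iso γ a * 𝒟.iso δ b) := by
  rw [← 𝒟.mul_iso γ δ a b ⟨a * b, SetLike.mul_mem_graded a.2 b.2⟩ rfl,
    𝒟.iso_of_degree_eq_zero h hγδ]

omit [DecidableEq Γ] [GradedAlgebra 𝒜] in
theorem valuation_κ {γ δ : Γ} (hγδ : γ + δ = 0) (P : PrimeDivisor R) :
    P.valuation (𝒟.κ γ δ : FractionRing R) = exp (-(𝒟.D γ P + 𝒟.D δ P)) := by
  have h1 := 𝒟.div_κ γ δ P
  rw [hγδ, 𝒟.D_zero, Finsupp.zero_apply, add_zero, PrimeDivisor.ord] at h1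
  rw [← h1, neg_neg, exp_log ((Valuation.ne_zero_iff _).2 (Units.ne_zero _))]

include 𝒟 in
theorem exists_mem_forall_degreeZeroProj_mul (l : S →ₗ[R] R) (γ : Γ) :
    ∃ s ∈ 𝒜 (-γ), ∀ t ∈ 𝒜 γ, degreeZeroProj 𝒜 h (s * t) = l t := by
  obtain ⟨c, hcv, hc⟩ := (𝒟.D γ).exists_eq_mul_of_linearMap
    (l ∘ₗ (𝒜 γ).subtype ∘ₗ (𝒟.iso γ).symm.toLinearMap)
  have hγ : -γ + γ = 0 := neg_add_cancel γ
  -- The representing element solves κ · x · f = c · f · `unitSection`; its orders are right because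
  -- div κ = D_γ + D_{-γ}.
  have hmem : c * (𝒟.κ (-γ) γ : FractionRing R)⁻¹ * 𝒟.unitSection ∈ (𝒟.D (-γ)).sections := by
    intro P
    rw [map_mul, 𝒟.valuation_unitSection h, mul_one, map_mul, map_inv₀, 𝒟.valuation_κ hγ,
      ← exp_neg, neg_neg]
    refine (mul_le_mul_left (hcv P) _).trans ?_
    rw [← exp_add, exp_le_exp]
    linarith
  refine ⟨(𝒟.iso (-γ)).symm ⟨_, hmem⟩, Subtype.property _, fun t ht => ?_⟩
  have h1 := 𝒟.algebraMap_degreeZeroProj_mul_unitSection h hγ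
    ((𝒟.iso (-γ)).symm ⟨_, hmem⟩) ⟨t, ht⟩
  have h2 := hc (𝒟.iso γ ⟨t, ht⟩)
  simp only [LinearMap.comp_apply, LinearEquiv.coe_coe, LinearEquiv.symm_apply_apply,
    Submodule.subtype_apply] at h2
  rw [LinearEquiv.apply_symm_apply] at h1
  refine IsFractionRing.injective R (FractionRing R) ?_
  refine mul_right_cancel₀ (𝒟.unitSection_ne_zero h) ?_
  rw [h1, h2]
  have h3 := (𝒟.κ (-γ) γ).ne_zero
  field_simp

include 𝒟 in
theorem exists_forall_degreeZeroProj_mul [Finite Γ] (l : S →ₗ[R] R) :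
    ∃ s, ∀ t, degreeZeroProj 𝒜 h (s * t) = l t := by
  cases nonempty_fintype Γ
  choose s hs hl using 𝒟.exists_mem_forall_degreeZeroProj_mul h l
  refine ⟨∑ γ, s γ, fun t => ?_⟩
  induction t using DirectSum.Decomposition.inductionOn 𝒜 with
  | zero => simp
  | @homogeneous γ t =>
    rw [Finset.sum_mul, map_sum, Finset.sum_eq_single γ]
    · exact hl γ t t.2
    · intro δ _ hδ
      refine degreeZeroProj_of_mem_ne 𝒜 h (γ := -δ + γ) ?_ (SetLike.mul_mem_graded (hs δ) t.2)
      rwa [Ne, neg_add_eq_zero]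
    · simp
  | add t t' ht ht' => rw [mul_add, map_add, ht, ht', map_add]

include 𝒟 in
theorem eq_zero_of_forall_degreeZeroProj_mul {s : S}
    (hs : ∀ t, degreeZeroProj 𝒜 h (s * t) = 0) : s = 0 := by
  have h0 : DirectSum.decompose 𝒜 s = 0 := by
    ext γ
    obtain ⟨f, hf, hf0⟩ := (𝒟.D (-γ)).exists_ne_zero_mem_sections
    have hγ : γ + -γ = 0 := add_neg_cancel γ
    have h1 := algebraMap_degreeZeroProj_mul 𝒜 h s hγ ((𝒟.iso (-γ)).symm ⟨f, hf⟩).2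
    rw [hs, map_zero] at h1
    have h2 := 𝒟.algebraMap_degreeZeroProj_mul_unitSection h hγ
      (DirectSum.decompose 𝒜 s γ) ((𝒟.iso (-γ)).symm ⟨f, hf⟩)
    rw [← h1, map_zero, map_zero, zero_mul, LinearEquiv.apply_symm_apply, eq_comm, mul_eq_zero,
      mul_eq_zero, or_iff_right (Units.ne_zero _), or_iff_left hf0, ZeroMemClass.coe_eq_zero,
      LinearEquiv.map_eq_zero_iff] at h2
    rw [h2]
    rfl
  rwa [← DirectSum.decompose_zero 𝒜, (DirectSum.decompose 𝒜).apply_eq_iff_eq] at h0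

/-- If the product were a unit, the order bounds on both factors would be equalities. Then D_γ =
-div a would be principal, against injectivity into the class group. -/
theorem degreeZeroProj_mul_mem_maximalIdeal [IsLocalRing R]
    (hCl : Function.Injective 𝒟.toClassGroup) {γ δ : Γ} (hγδ : γ + δ = 0) (hγ : γ ≠ 0)
    (a : 𝒜 γ) (b : 𝒜 δ) : degreeZeroProj 𝒜 h (a * b) ∈ IsLocalRing.maximalIdeal R := by
  rw [IsLocalRing.mem_maximalIdeal]
  intro hu
  have hne : (𝒟.iso γ a : FractionRing R) ≠ 0 := by
    intro h0
    rw [ZeroMemClass.coe_eq_zero, LinearEquiv.map_eq_zero_iff] at h0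
    rw [h0, ZeroMemClass.coe_zero, zero_mul, map_zero] at hu
    exact not_isUnit_zero hu
  have hv : ∀ P : PrimeDivisor R, P.valuation (𝒟.iso γ a : FractionRing R) = exp (𝒟.D γ P) := by
    intro P
    refine le_antisymm ((𝒟.iso γ a).2 P) ?_
    have h1 := congrArg P.valuation (𝒟.algebraMap_degreeZeroProj_mul_unitSection h hγδ a b)
    rw [map_mul, 𝒟.valuation_unitSection h, mul_one, P.valuation_algebraMap_eq_one
      (fun hP => P.1.2.ne_top (Ideal.eq_top_of_isUnit_mem _ hP hu)), map_mul, map_mul,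
      𝒟.valuation_κ hγδ] at h1
    have h2 := (𝒟.iso δ b).2 P
    have h3 := (Valuation.ne_zero_iff P.valuation).2 hne
    have h4 : (1 : ℤᵐ⁰) ≤ exp (-(𝒟.D γ P + 𝒟.D δ P)) *
        (P.valuation (𝒟.iso γ a : FractionRing R) * exp (𝒟.D δ P)) := by
      rw [h1]
      exact mul_le_mul_right (mul_le_mul_right h2 _) _
    rw [← exp_log h3, ← exp_add, ← exp_add, ← exp_zero, exp_le_exp] at h4
    rw [← exp_log h3, exp_le_exp]
    linarith
  refine hγ (hCl ?_)
  rw [map_zero]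
  refine (QuotientAddGroup.eq_zero_iff _).2 ⟨(Units.mk0 _ hne)⁻¹, fun P => ?_⟩
  rw [PrimeDivisor.ord, Units.val_inv_eq_inv_val, Units.val_mk0, map_inv₀, hv, ← exp_neg, log_exp,
    neg_neg]

/-- Modulo the transpose of the maximal ideal, s equals T(s), since products of opposite nonzero
degrees lie in the maximal ideal. That transpose lies in every maximal ideal of S, so a maximal
ideal containing s would contain the unit T(s). -/
theorem isUnit_of_degreeZeroProj_isUnit [Finite Γ] [Algebra.IsIntegral R S] [IsLocalRing R]
    (hCl : Function.Injective 𝒟.toClassGroup) {s : S} (hs : IsUnit (degreeZeroProj 𝒜 h s)) :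
    IsUnit s := by
  by_contra hns
  obtain ⟨M, hM, hsM⟩ := exists_max_ideal_of_mem_nonunits hns
  have hmax := Ideal.isMaximal_comap_of_isIntegral_of_isMaximal (R := R) M
  have hd : s - algebraMap R S (degreeZeroProj 𝒜 h s) ∈
      transposeIdeal (degreeZeroProj 𝒜 h) (IsLocalRing.maximalIdeal R) := by
    intro t
    induction t using DirectSum.Decomposition.inductionOn 𝒜 with
    | zero => simp
    | @homogeneous δ t =>
      rw [sub_mul, map_sub, apply_algebraMap_mul]
      by_cases hδ : δ = 0
      · subst hδ
        have ht := algebraMap_degreeZeroProj_of_mem 𝒜 h t.2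
        rw [← ht, mul_comm s, apply_algebraMap_mul, degreeZeroProj_algebraMap, mul_comm, sub_self]
        exact Ideal.zero_mem _
      · rw [degreeZeroProj_of_mem_ne 𝒜 h hδ t.2, mul_zero, sub_zero]
        have hδ' : -δ + δ = 0 := neg_add_cancel δ
        have h1 := algebraMap_degreeZeroProj_mul 𝒜 h s hδ' t.2
        have h2 := 𝒟.degreeZeroProj_mul_mem_maximalIdeal h hCl hδ' (neg_ne_zero.2 hδ)
          (DirectSum.decompose 𝒜 s (-δ)) t
        rwa [← h1, degreeZeroProj_algebraMap] at h2
    | add t t' ht ht' => rw [mul_add, map_add]; exact Ideal.add_mem _ ht ht'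
  have hle : (IsLocalRing.maximalIdeal R).map (algebraMap R S) ≤ M := by
    rw [Ideal.map_le_iff_le_comap, IsLocalRing.eq_maximalIdeal hmax]
  have hdM := (hM.isPrime.radical_le_iff.2 hle)
    (transposeIdeal_degreeZeroProj_le_radical 𝒜 h _ hd)
  have h1 := M.sub_mem hsM hdM
  rw [sub_sub_cancel] at h1
  exact hM.ne_top (Ideal.eq_top_of_isUnit_mem _ h1 (hs.map _))

end DivisorialPresentation

end Graded

/-! ### Compatible primes in radicial extensions -/

section Radicial

variable {p e : ℕ} {R A : Type*} [CommRing R] [CommRing A] [Algebra R A]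

/-- If `A` is radicial over `R`, the trace maps a compatible prime over `P` into `P`. -/
theorem apply_mem_of_pow_mem_range [IsNoetherianRing A] {T : A →ₗ[R] R} (hT : T 1 = 1)
    {φ : CartierMap p e R} {ψ : CartierMap p e A} (h : ∀ s, T (ψ s) = φ (T s))
    (hp : p ^ e ≠ 0) (hpow : ∀ s : A, ∃ r, algebraMap R A r = s ^ p ^ e)
    {P : Ideal R} [P.IsPrime] {Q : Ideal A} [Q.IsPrime] (hQP : Q.comap (algebraMap R A) = P)
    (hQ : ψ.IsCompatible Q) (hc : ∃ c, ψ c ∉ Q) {s : A} (hs : s ∈ Q) : T s ∈ P := by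
  classical
  have hmem : ∀ r, algebraMap R A r ∈ Q ↔ r ∈ P := fun r => by rw [← hQP, Ideal.mem_comap]
  have hrad : Q ≤ (transposeIdeal T P).radical := by
    intro x hx
    obtain ⟨r, hr⟩ := hpow x
    refine ⟨p ^ e, map_le_transposeIdeal T P ?_⟩
    rw [← hr]
    refine Ideal.mem_map_of_mem _ ((hmem r).1 ?_)
    rw [hr]
    exact Q.pow_mem_of_mem hx _ (Nat.pos_of_ne_zero hp)
  -- Take the least N with Q^N ⊆ P^T. It is positive since T(1) = 1, and z ∈ Q^(N-1) outside P^T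
  -- satisfies (P^T : z) = Q.
  have hex := Ideal.exists_pow_le_of_le_radical_of_fg hrad (IsNoetherian.noetherian Q)
  have h0 : Nat.find hex ≠ 0 := by
    intro h0
    have h1 := Nat.find_spec hex
    rw [h0, pow_zero, Ideal.one_eq_top, top_le_iff] at h1
    have h2 : (1 : A) ∈ transposeIdeal T P := by rw [h1]; exact Submodule.mem_top
    have h3 := mem_of_mem_transposeIdeal h2
    rw [hT] at h3
    exact Ideal.IsPrime.ne_top ‹_› ((Ideal.eq_top_iff_one _).2 h3)
  obtain ⟨k, hk⟩ := Nat.exists_eq_succ_of_ne_zero h0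
  obtain ⟨z, hzQ, hz⟩ := Set.not_subset.1 (Nat.find_min hex (m := k) (by omega))
  have hzmul : ∀ w ∈ Q, z * w ∈ transposeIdeal T P := by
    intro w hw
    refine Nat.find_spec hex ?_
    rw [hk, pow_succ]
    exact Ideal.mul_mem_mul hzQ hw
  have hcolon : ∀ w, z * w ∈ transposeIdeal T P → w ∈ Q := by
    intro w hw
    obtain ⟨r, hr⟩ := hpow w
    by_contra hwQ
    refine hz (mem_transposeIdeal_of_algebraMap_mul_mem (r := r) ?_ ?_)
    · rw [← hmem, hr]
      exact fun hh => hwQ (Ideal.IsPrime.mem_of_pow_mem ‹_› _ hh)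
    · obtain ⟨j, hj⟩ := Nat.exists_eq_succ_of_ne_zero hp
      rw [hr, hj, pow_succ, show w ^ j * w * z = w ^ j * (z * w) by ring]
      exact Ideal.mul_mem_left _ _ hw
  obtain ⟨ζ, hζ⟩ := hpow z
  -- Put ζ = z^q ∈ R. Since ψ(xs) ∈ Q, the element zψ(xs) lies in P^T; applying T moves z inside φ
  -- as ζ.
  have hJ : ∀ x : R, φ (ζ * (T s * x)) ∈ P := by
    intro x
    have h1 := mem_of_mem_transposeIdeal (hzmul _ (hQ _ (Q.mul_mem_left (algebraMap R A x) hs)))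
    rwa [apply_mul_eq_of_comm h, ← hζ, apply_algebraMap_mul, apply_algebraMap_mul,
      mul_comm x] at h1
  by_contra hr
  -- If T(s) ∉ P, reading the previous relation backwards through (P^T : z) = Q gives ψ(T(s)A) ⊆ Q.
  -- Pulling T(s) out as a q-th power then gives ψ(A) ⊆ Q, a contradiction.
  have hψ : ∀ t, ψ (algebraMap R A (T s) * t) ∈ Q := by
    intro t
    refine hcolon _ fun y => ?_
    rw [show z * ψ (algebraMap R A (T s) * t) * y = y * z * ψ (algebraMap R A (T s) * t) by ring,
      apply_mul_eq_of_comm h, mul_pow, ← hζ,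
      show y ^ p ^ e * algebraMap R A ζ * (algebraMap R A (T s) * t) =
        algebraMap R A ζ * (algebraMap R A (T s) * (y ^ p ^ e * t)) by ring,
      apply_algebraMap_mul, apply_algebraMap_mul]
    exact hJ _
  obtain ⟨c, hc⟩ := hc
  obtain ⟨j, hj⟩ := Nat.exists_eq_succ_of_ne_zero hp
  have h1 := hψ (algebraMap R A (T s) ^ j * c)
  rw [← mul_assoc, ← pow_succ', ← Nat.succ_eq_add_one, ← hj, ψ.apply_pow_mul] at h1
  exact (Ideal.IsPrime.mem_or_mem ‹_› h1).elim (fun h2 => hr ((hmem _).1 h2)) hc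

/-- The restriction of a Cartier map to a stable subalgebra. -/
def CartierMap.restrict (ψ : CartierMap p e A) (B : Subalgebra R A) (hB : ∀ s ∈ B, ψ s ∈ B) :
    CartierMap p e B where
  toFun s := ⟨ψ s, hB s s.2⟩
  map_zero' := Subtype.ext ψ.apply_zero
  map_add' a b := Subtype.ext (ψ.apply_add a b)
  map_pow_mul' a b := Subtype.ext (ψ.apply_pow_mul a b)

end Radicial

/-! ### Graded subalgebras and contraction of compatible primes -/

section GradedSubalgebra

variable {R S Γ : Type*} [CommRing R] [CommRing S] [Algebra R S] [AddCommGroup Γ]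
  [DecidableEq Γ] (𝒜 : Γ → Submodule R S) [GradedAlgebra 𝒜]

/-- The subalgebra `⨁ S_γ`, where `γ` runs over a subgroup of the grading group. -/
def gradedSubalgebra (H : AddSubgroup Γ) : Subalgebra R S :=
  (⨆ γ : H, 𝒜 γ).toSubalgebra
    (Submodule.mem_iSup_of_mem (p := fun γ : H => 𝒜 γ) 0 (SetLike.one_mem_graded 𝒜))
    (fun x y hx hy => by
      refine Submodule.iSup_induction (fun γ : H => 𝒜 γ)
        (motive := fun x => x * y ∈ ⨆ γ : H, 𝒜 γ) hx (fun γ x hx => ?_) ?_ ?_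
      · refine Submodule.iSup_induction (fun γ : H => 𝒜 γ)
          (motive := fun y => x * y ∈ ⨆ γ : H, 𝒜 γ) hy (fun δ y hy => ?_) ?_ ?_
        · exact Submodule.mem_iSup_of_mem (p := fun γ : H => 𝒜 γ) (γ + δ)
            (SetLike.mul_mem_graded hx hy)
        · rw [mul_zero]; exact Submodule.zero_mem _
        · intro y y' hy hy'
          rw [mul_add]; exact Submodule.add_mem _ hy hy'
      · rw [zero_mul]; exact Submodule.zero_mem _
      · intro x x' hx hx'
        rw [add_mul]; exact Submodule.add_mem _ hx hx')

theorem mem_gradedSubalgebra_of_decompose {H : AddSubgroup Γ} {s : S}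
    (hs : ∀ γ ∉ H, (DirectSum.decompose 𝒜 s γ : S) = 0) : s ∈ gradedSubalgebra 𝒜 H := by
  classical
  rw [← DirectSum.sum_support_decompose 𝒜 s]
  refine Subalgebra.sum_mem _ fun γ _ => ?_
  by_cases hγ : γ ∈ H
  · exact Submodule.mem_iSup_of_mem (p := fun γ : H => 𝒜 γ) ⟨γ, hγ⟩ (Subtype.property _)
  · rw [hs γ hγ]
    exact Subalgebra.zero_mem _

theorem gradedSubalgebra_induction {H : AddSubgroup Γ} {motive : S → Prop} {s : S}
    (hs : s ∈ gradedSubalgebra 𝒜 H) (mem : ∀ γ ∈ H, ∀ x ∈ 𝒜 γ, motive x) (zero : motive 0)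
    (add : ∀ x y, motive x → motive y → motive (x + y)) : motive s :=
  Submodule.iSup_induction (fun γ : H => 𝒜 γ) (motive := motive) hs (fun γ x hx => mem γ γ.2 x hx) zero add

theorem pow_mem_of_mem_gradedSubalgebra {p : ℕ} [Fact p.Prime] [CharP S p] {H : AddSubgroup Γ}
    {k : ℕ} (hH : ∀ γ ∈ H, p ^ k • γ = 0) {s : S} (hs : s ∈ gradedSubalgebra 𝒜 H) :
    s ^ p ^ k ∈ 𝒜 0 := by
  refine gradedSubalgebra_induction 𝒜 (motive := fun s => s ^ p ^ k ∈ 𝒜 0) hs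
    (fun γ hγ x hx => ?_) ?_ fun x y hx hy => ?_
  · rw [← hH γ hγ]
    exact SetLike.pow_mem_graded _ hx
  · rw [zero_pow (pow_ne_zero _ (Fact.out : p.Prime).ne_zero)]
    exact Submodule.zero_mem _
  · rw [add_pow_char_pow]
    exact Submodule.add_mem _ hx hy

theorem degreeZeroProj_mul_eq_zero (h : IsDegreeZeroPart 𝒜) {H : AddSubgroup Γ} {γ : Γ}
    (hγ : γ ∉ H) {s t : S} (ht : t ∈ 𝒜 γ) (hs : s ∈ gradedSubalgebra 𝒜 H) :
    degreeZeroProj 𝒜 h (t * s) = 0 := by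
  refine gradedSubalgebra_induction 𝒜 (motive := fun s => degreeZeroProj 𝒜 h (t * s) = 0) hs
    (fun δ hδ x hx => ?_) ?_ fun x y hx hy => ?_
  · refine degreeZeroProj_of_mem_ne 𝒜 h (γ := γ + δ) (fun h0 => hγ ?_)
      (SetLike.mul_mem_graded ht hx)
    rw [eq_neg_of_add_eq_zero_left h0]
    exact H.neg_mem hδ
  · rw [mul_zero, map_zero]
  · rw [mul_add, map_add, hx, hy, add_zero]

variable {𝒜} {p e : ℕ} {φ : CartierMap p e R} {ψ : CartierMap p e S}

/-- For γ ∉ H the component ψ(s)_γ is tested against t of degree -γ: T(tψ(s)) = φ(T(t^q s)), and t^q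
has degree -qγ ∉ H, so it pairs to zero with s. -/
theorem apply_mem_gradedSubalgebra (h : IsDegreeZeroPart 𝒜)
    (hnd : ∀ s, (∀ t, degreeZeroProj 𝒜 h (s * t) = 0) → s = 0)
    (hψ : ∀ s, degreeZeroProj 𝒜 h (ψ s) = φ (degreeZeroProj 𝒜 h s)) {H : AddSubgroup Γ}
    (hH : ∀ γ, p ^ e • γ ∈ H → γ ∈ H) {s : S} (hs : s ∈ gradedSubalgebra 𝒜 H) :
    ψ s ∈ gradedSubalgebra 𝒜 H := by
  refine mem_gradedSubalgebra_of_decompose 𝒜 fun γ hγ => hnd _ fun t => ?_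
  induction t using DirectSum.Decomposition.inductionOn 𝒜 with
  | zero => simp
  | @homogeneous δ t =>
    by_cases hδ : γ + δ = 0
    · apply h.1
      rw [← algebraMap_degreeZeroProj_mul 𝒜 h _ hδ t.2, degreeZeroProj_algebraMap, mul_comm,
        apply_mul_eq_of_comm hψ, degreeZeroProj_mul_eq_zero 𝒜 h (H := H) (γ := p ^ e • δ) ?_
        (SetLike.pow_mem_graded _ t.2) hs, φ.apply_zero]
      intro hmem
      refine hγ ?_
      rw [eq_neg_of_add_eq_zero_left hδ]
      exact H.neg_mem (hH _ hmem)
    · exact degreeZeroProj_of_mem_ne 𝒜 h hδ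
        (SetLike.mul_mem_graded (Subtype.property _) t.2)
  | add t t' ht ht' => rw [mul_add, map_add, ht, ht', add_zero]

/-- Compatible primes of `S` contract to compatible primes of `R`. -/
theorem isCompatible_comap_of_isCompatible [Finite Γ] [Module.Finite R S] [IsNoetherianRing R]
    [Fact p.Prime] [CharP S p] (he : 0 < e) (h : IsDegreeZeroPart 𝒜)
    (hnd : ∀ s, (∀ t, degreeZeroProj 𝒜 h (s * t) = 0) → s = 0)
    (hunit : ∀ s, IsUnit (degreeZeroProj 𝒜 h s) → IsUnit s)
    (hφ : Function.Surjective φ)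
    (hψ : ∀ s, degreeZeroProj 𝒜 h (ψ s) = φ (degreeZeroProj 𝒜 h s))
    {Q : Ideal S} [Q.IsPrime] (hQ : ψ.IsCompatible Q) :
    φ.IsCompatible (Q.comap (algebraMap R S)) := by
  have hp : p.Prime := Fact.out
  set n := Nat.card Γ with hn
  -- H is the whole p-primary part: an element of order p^b has b < p^b ≤ n ≤ en. Thus p^e γ ∈ H
  -- implies γ ∈ H, which ψ-stability needs.
  let H : AddSubgroup Γ := (nsmulAddMonoidHom (p ^ (e * n)) : Γ →+ Γ).ker
  have hHmem : ∀ γ, γ ∈ H ↔ p ^ (e * n) • γ = 0 := fun γ => Iff.rfl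
  have hH : ∀ γ, p ^ e • γ ∈ H → γ ∈ H := by
    intro γ hγ
    rw [hHmem, ← mul_nsmul', ← pow_add] at hγ
    obtain ⟨b, -, hb⟩ := (Nat.dvd_prime_pow hp).1 (addOrderOf_dvd_iff_nsmul_eq_zero.2 hγ)
    rw [hHmem, ← addOrderOf_dvd_iff_nsmul_eq_zero, hb]
    refine pow_dvd_pow p ?_
    have h1 : p ^ b ≤ n := by rw [← hb]; exact Nat.le_of_dvd Nat.card_pos (addOrderOf_dvd_natCard γ)
    have h2 : b < p ^ b := Nat.lt_pow_self hp.one_lt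
    exact (h2.le.trans h1).trans (Nat.le_mul_of_pos_left n he)
  let B := gradedSubalgebra 𝒜 H
  have hB : ∀ s ∈ B, ψ s ∈ B := fun s hs => apply_mem_gradedSubalgebra h hnd hψ hH hs
  let ψB := ψ.restrict B hB
  let T : B →ₗ[R] R := degreeZeroProj 𝒜 h ∘ₗ B.val.toLinearMap
  have hT1 : T 1 = 1 := degreeZeroProj_one 𝒜 h
  have hcomm : ∀ s : B, T (ψB s) = φ (T s) := fun s => hψ s
  have hcommn : ∀ s : B, T (ψB.pow n s) = φ.pow n (T s) := fun s =>
    (Function.Semiconj.iterate_right (f := T) hcomm n) s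
  have : IsNoetherian R S := isNoetherian_of_isNoetherianRing_of_finite R S
  have : IsNoetherian R B := isNoetherian_submodule' (Subalgebra.toSubmodule B)
  have : IsNoetherianRing B := isNoetherian_of_tower R ‹_›
  let QB : Ideal B := Q.comap B.val
  have hQB : ψB.IsCompatible QB := fun s hs => hQ _ hs
  have hQT : ∀ s ∈ QB, T s ∈ Q.comap (algebraMap R S) := by
    intro s hs
    -- Only p^(en)-th powers of B are known to lie in R, so the n-th iterates of φ and ψ are used.
    -- The iterate of ψ is nonzero modulo Q because it takes a unit value.
    refine apply_mem_of_pow_mem_range (Q := QB) hT1 hcommn (pow_ne_zero _ hp.ne_zero) ?_ rfl ?_ ?_ hs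
    · intro s
      have h1 := pow_mem_of_mem_gradedSubalgebra 𝒜 (p := p) (k := e * n)
        (fun γ hγ => (hHmem γ).1 hγ) s.2
      obtain ⟨r, hr⟩ := (h.2 _).1 h1
      exact ⟨r, Subtype.ext hr⟩
    · exact fun s hs => hQB.iterate n hs
    · obtain ⟨a, ha⟩ := hφ.iterate n 1
      refine ⟨algebraMap R B a, fun hmem => ?_⟩
      have h1 := hcommn (algebraMap R B a)
      rw [show T (algebraMap R B a) = a from degreeZeroProj_algebraMap 𝒜 h a,
        show φ.pow n a = 1 from ha] at h1
      exact Ideal.IsPrime.ne_top ‹_› (Ideal.eq_top_of_isUnit_mem Q hmem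
        (hunit _ ((show degreeZeroProj 𝒜 h _ = 1 from h1) ▸ isUnit_one)))
  intro a ha
  have h1 := hQT (ψB (algebraMap R B a)) (hQB _ ha)
  rwa [hcomm, show T (algebraMap R B a) = a from degreeZeroProj_algebraMap 𝒜 h a] at h1

end GradedSubalgebra

theorem CartierMap.isClosed_cartierZariski {p e : ℕ} {A : Type*} [CommRing A]
    (φ : CartierMap p e A) {Z : Set (PrimeSpectrum A)} :
    @IsClosed _ φ.cartierZariski Z ↔
      ∃ I : Ideal A, φ.IsCompatible I ∧ Z = PrimeSpectrum.zeroLocus (I : Set A) := by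
  have key : @IsOpen _ φ.cartierZariski Zᶜ ↔
      ∃ I : Ideal A, φ.IsCompatible I ∧ Zᶜᶜ = PrimeSpectrum.zeroLocus (I : Set A) := Iff.rfl
  rw [← @isOpen_compl_iff _ _ φ.cartierZariski, key, compl_compl]

/-! ### Reduced fibers and fibered transpositions -/

section Fibers

variable {R S : Type*} [CommRing R] [CommRing S] [Algebra R S] {p e : ℕ}

theorem toReducedFiber_algebraMap (P : PrimeSpectrum R) (r : R) :
    toReducedFiber S P (algebraMap R S r) =
      algebraMap P.asIdeal.ResidueField (ReducedFiber S P)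
        (algebraMap R P.asIdeal.ResidueField r) := by
  rw [← IsScalarTower.algebraMap_apply R P.asIdeal.ResidueField (ReducedFiber S P)]
  change Ideal.Quotient.mk _ ((Algebra.TensorProduct.includeRight :
    S →ₐ[R] P.asIdeal.Fiber S) (algebraMap R S r)) = _
  rw [AlgHom.commutes]
  rfl

theorem exists_mul_eq_toReducedFiber (P : PrimeSpectrum R) (x : ReducedFiber S P) :
    ∃ r ∉ P.asIdeal, ∃ s, x * toReducedFiber S P (algebraMap R S r) = toReducedFiber S P s := by
  obtain ⟨y, rfl⟩ := Ideal.Quotient.mk_surjective x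
  obtain ⟨r, hr, s, hs⟩ := Ideal.Fiber.exists_smul_eq_one_tmul P.asIdeal y
  refine ⟨r, hr, s, ?_⟩
  have h1 : toReducedFiber S P s = Ideal.Quotient.mk _ (r • y) := by rw [hs]; rfl
  have h2 : toReducedFiber S P (algebraMap R S r) =
      Ideal.Quotient.mk _ (algebraMap R (P.asIdeal.Fiber S) r) :=
    congrArg _ ((Algebra.TensorProduct.includeRight : S →ₐ[R] P.asIdeal.Fiber S).commutes r)
  rw [h1, h2, Algebra.smul_def, ← map_mul, mul_comm]

/-- The base change of a linear form to the fiber over `P`. -/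
noncomputable def fiberForm (T : S →ₗ[R] R) (P : PrimeSpectrum R) :
    P.asIdeal.Fiber S →ₗ[P.asIdeal.ResidueField] P.asIdeal.ResidueField :=
  (TensorProduct.AlgebraTensorModule.rid R P.asIdeal.ResidueField
    P.asIdeal.ResidueField).toLinearMap ∘ₗ T.baseChange P.asIdeal.ResidueField

theorem fiberForm_one_tmul (T : S →ₗ[R] R) (P : PrimeSpectrum R) (s : S) :
    fiberForm T P (1 ⊗ₜ s) = algebraMap R P.asIdeal.ResidueField (T s) := by
  simp [fiberForm, Algebra.algebraMap_eq_smul_one]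

variable {T : S →ₗ[R] R} {P : PrimeSpectrum R}

/-- When (1 ⊗ s)^n = 0, every T(s^n t) vanishes in κ(P), so s^n ∈ P^T; radicality removes the
exponent. This lets T descend to the reduced fiber. -/
theorem mem_transposeIdeal_of_isNilpotent (hrad : (transposeIdeal T P.asIdeal).IsRadical) {s : S}
    (hs : IsNilpotent ((1 : P.asIdeal.ResidueField) ⊗ₜ[R] s)) :
    s ∈ transposeIdeal T P.asIdeal := by
  obtain ⟨n, hn⟩ := hs
  refine hrad ⟨n, fun t => ?_⟩
  rw [Algebra.TensorProduct.tmul_pow, one_pow] at hn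
  have h1 : (1 : P.asIdeal.ResidueField) ⊗ₜ[R] (s ^ n * t) = 0 := by
    rw [← one_mul (1 : P.asIdeal.ResidueField), ← Algebra.TensorProduct.tmul_mul_tmul, hn,
      zero_mul]
  have h2 := fiberForm_one_tmul T P (s ^ n * t)
  rw [h1, map_zero, eq_comm, Ideal.algebraMap_residueField_eq_zero] at h2
  exact h2

theorem fiberForm_eq_zero_of_isNilpotent (hrad : (transposeIdeal T P.asIdeal).IsRadical)
    {x : P.asIdeal.Fiber S} (hx : IsNilpotent x) : fiberForm T P x = 0 := by
  obtain ⟨r, hr, s, hs⟩ := Ideal.Fiber.exists_smul_eq_one_tmul P.asIdeal x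
  have h1 : IsNilpotent ((1 : P.asIdeal.ResidueField) ⊗ₜ[R] s) := by
    rw [← hs]; exact hx.smul r
  have h2 := mem_of_mem_transposeIdeal (mem_transposeIdeal_of_isNilpotent hrad h1)
  rw [← Ideal.algebraMap_residueField_eq_zero, ← fiberForm_one_tmul, ← hs,
    ← algebraMap_smul P.asIdeal.ResidueField r x, map_smul, smul_eq_mul, mul_eq_zero,
    Ideal.algebraMap_residueField_eq_zero] at h2
  exact h2.resolve_left hr

theorem exists_reducedFiberForm (hrad : (transposeIdeal T P.asIdeal).IsRadical) :
    ∃ TP : ReducedFiber S P →ₗ[P.asIdeal.ResidueField] P.asIdeal.ResidueField,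
      ∀ s, TP (toReducedFiber S P s) = algebraMap R P.asIdeal.ResidueField (T s) := by
  have hsurj : Function.Surjective (Ideal.Quotient.mk (nilradical (P.asIdeal.Fiber S))) :=
    Ideal.Quotient.mk_surjective
  have key : ∀ y, fiberForm T P (Function.surjInv hsurj (Ideal.Quotient.mk _ y)) =
      fiberForm T P y := by
    intro y
    rw [← sub_eq_zero, ← map_sub]
    refine fiberForm_eq_zero_of_isNilpotent hrad (mem_nilradical.1 ?_)
    rw [← Ideal.Quotient.eq]
    exact Function.surjInv_eq hsurj _
  refine ⟨{ toFun := fun x => fiberForm T P (Function.surjInv hsurj x)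
            map_add' := fun x y => ?_, map_smul' := fun c x => ?_ }, fun s => ?_⟩
  · obtain ⟨x, rfl⟩ := hsurj x
    obtain ⟨y, rfl⟩ := hsurj y
    rw [← map_add, key, key, key, map_add]
  · obtain ⟨x, rfl⟩ := hsurj x
    rw [show c • Ideal.Quotient.mk (nilradical (P.asIdeal.Fiber S)) x =
      Ideal.Quotient.mk _ (c • x) from rfl, key, key, map_smul, RingHom.id_apply]
  · rw [← fiberForm_one_tmul]
    exact key _

/-- Identifies the kernel with an ideal known to be ψ-compatible, as needed for ψ to descend. -/
theorem ker_toReducedFiber (hrad : (transposeIdeal T P.asIdeal).IsRadical)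
    (hle : transposeIdeal T P.asIdeal ≤ (P.asIdeal.map (algebraMap R S)).radical) :
    RingHom.ker (toReducedFiber S P) = transposeIdeal T P.asIdeal := by
  refine le_antisymm (fun s hs => ?_) fun s hs => ?_
  · refine mem_transposeIdeal_of_isNilpotent hrad (mem_nilradical.1 ?_)
    exact Ideal.Quotient.eq_zero_iff_mem.1 hs
  · have h1 : P.asIdeal.map (algebraMap R S) ≤ RingHom.ker (toReducedFiber S P) := by
      rw [Ideal.map_le_iff_le_comap]
      intro r hr
      rw [Ideal.mem_comap, RingHom.mem_ker, toReducedFiber_algebraMap,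
        Ideal.algebraMap_residueField_eq_zero.2 hr, map_zero]
    obtain ⟨n, hn⟩ := hle hs
    have h2 : IsNilpotent (toReducedFiber S P s) := ⟨n, by rw [← map_pow]; exact h1 hn⟩
    have h3 : IsReduced (ReducedFiber S P) :=
      (Ideal.isRadical_iff_quotient_reduced _).1 (Ideal.radical_isRadical _)
    exact h2.eq_zero

variable {φ : CartierMap p e R} {ψ : CartierMap p e S}

theorem exists_isHom_reducedFiber (hp : p ^ e ≠ 0) (h : ∀ s, T (ψ s) = φ (T s))
    (hrad : (transposeIdeal T P.asIdeal).IsRadical)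
    (hle : transposeIdeal T P.asIdeal ≤ (P.asIdeal.map (algebraMap R S)).radical)
    (hP : P ∈ φ.CSpec) :
    ∃ ψP : CartierMap p e (ReducedFiber S P), CartierMap.IsHom (toReducedFiber S P) ψ ψP := by
  refine ψ.exists_isHom_of_fractions _ hp ?_
    (P.asIdeal.primeCompl.map (algebraMap R S : R →* S)) ?_ ?_
  · rw [ker_toReducedFiber hrad hle]
    exact transposeIdeal_isCompatible h hP
  · rintro _ ⟨r, hr, rfl⟩
    change IsUnit (toReducedFiber S P (algebraMap R S r))
    rw [toReducedFiber_algebraMap]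
    refine IsUnit.map _ (isUnit_iff_ne_zero.2 ?_)
    rw [Ne, Ideal.algebraMap_residueField_eq_zero]
    exact hr
  · intro x
    obtain ⟨r, hr, s, hs⟩ := exists_mul_eq_toReducedFiber P x
    exact ⟨s, _, ⟨r, hr, rfl⟩, hs⟩

theorem reducedFiber_comm (hp : p ^ e ≠ 0) (h : ∀ s, T (ψ s) = φ (T s))
    {φP : CartierMap p e P.asIdeal.ResidueField} {ψP : CartierMap p e (ReducedFiber S P)}
    {TP : ReducedFiber S P →ₗ[P.asIdeal.ResidueField] P.asIdeal.ResidueField}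
    (hφP : CartierMap.IsHom (algebraMap R P.asIdeal.ResidueField) φ φP)
    (hψP : CartierMap.IsHom (toReducedFiber S P) ψ ψP)
    (hTP : ∀ s, TP (toReducedFiber S P s) = algebraMap R P.asIdeal.ResidueField (T s))
    (x : ReducedFiber S P) : TP (ψP x) = φP (TP x) := by
  obtain ⟨r, hr, s, hs⟩ := exists_mul_eq_toReducedFiber P x
  obtain ⟨k, hk⟩ := Nat.exists_eq_succ_of_ne_zero hp
  set ρ := algebraMap R P.asIdeal.ResidueField r with hρ
  have hρ0 : ρ ≠ 0 := by rwa [Ne, Ideal.algebraMap_residueField_eq_zero]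
  have hTρ : ∀ y, TP (toReducedFiber S P (algebraMap R S r) * y) = ρ * TP y := by
    intro y
    rw [toReducedFiber_algebraMap, ← Algebra.smul_def, map_smul, smul_eq_mul]
  have h1 : toReducedFiber S P (algebraMap R S r) * ψP x =
      toReducedFiber S P (ψ (algebraMap R S r ^ k * s)) := by
    rw [← ψP.apply_pow_mul, hk, Nat.succ_eq_add_one, pow_succ, mul_assoc, mul_comm _ x, hs,
      ← map_pow, ← map_mul, hψP]
  have h2 : ρ ^ k * (ρ * TP x) = algebraMap R P.asIdeal.ResidueField (r ^ k * T s) := by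
    rw [← hTρ, mul_comm _ x, hs, hTP, map_mul, map_pow]
  refine mul_left_cancel₀ hρ0 ?_
  rw [← hTρ, h1, hTP, h, ← map_pow, apply_algebraMap_mul, ← φP.apply_pow_mul, hk,
    Nat.succ_eq_add_one, pow_succ, mul_assoc, h2, hφP]

theorem isFibered_of_surjective (hp : 1 < p ^ e) (hT : T 1 = 1) (h : ∀ s, T (ψ s) = φ (T s))
    (hψ : Function.Surjective ψ) (hφ : Function.Surjective φ)
    (hle : ∀ I, transposeIdeal T I ≤ (I.map (algebraMap R S)).radical) : IsFibered T φ ψ where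
  nondegenerate := ⟨1, by rw [hT]; exact one_mem _⟩
  comm := h
  continuous_comap := by
    rw [@continuous_iff_isClosed _ _ ψ.cartierZariski φ.cartierZariski]
    intro Z hZ
    obtain ⟨I, hI, rfl⟩ := φ.isClosed_cartierZariski.1 hZ
    refine ψ.isClosed_cartierZariski.2 ⟨_, transposeIdeal_isCompatible h hI, ?_⟩
    rw [PrimeSpectrum.preimage_comap_zeroLocus, ← PrimeSpectrum.zeroLocus_span,
      ← Ideal.map]
    refine le_antisymm ?_ (PrimeSpectrum.zeroLocus_anti_mono (map_le_transposeIdeal T I))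
    rw [← PrimeSpectrum.zeroLocus_radical (I.map (algebraMap R S))]
    exact PrimeSpectrum.zeroLocus_anti_mono (hle I)
  isRadical P hP := (transposeIdeal_isCompatible h hP).isRadical hψ hp
  fiber P hP := by
    have hp0 : p ^ e ≠ 0 := (zero_lt_one.trans hp).ne'
    have hrad := (transposeIdeal_isCompatible h hP).isRadical hψ hp
    obtain ⟨φP, hφP⟩ := φ.exists_isHom_residueField hp0 hP
    obtain ⟨ψP, hψP⟩ := exists_isHom_reducedFiber hp0 h hrad (hle _) hP
    obtain ⟨TP, hTP⟩ := exists_reducedFiberForm hrad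
    refine ⟨φP, ψP, TP, hφP, hψP, hTP, reducedFiber_comm hp0 h hφP hψP hTP, fun _ => ?_,
      fun h0 => ?_⟩
    · obtain ⟨c, hc⟩ := hψ 1
      refine CartierMap.isFPure_of_surjective (ψP.surjective_of_apply_isUnit
        (a := toReducedFiber S P c) ?_)
      rw [hψP, hc, map_one]
      exact isUnit_one
    -- This case is vacuous: a preimage of 1 under φ shows that the induced map is nonzero.
    · obtain ⟨c, hc⟩ := hφ 1
      have h1 := hφP c
      rw [h0, hc, map_one] at h1
      exact absurd h1 zero_ne_one

/-- By incomparability in integral extensions, primes over P are minimal over PS, hence over its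
radical P^T. -/
theorem fiberSet_subset_CSpec [Algebra.IsIntegral R S] (hp : p ^ e ≠ 0)
    (h : ∀ s, T (ψ s) = φ (T s)) (hP : P ∈ φ.CSpec) (hram : IsTamelyRamified T P) :
    fiberSet S P ⊆ ψ.CSpec := by
  intro Q hQ
  have hI := transposeIdeal_isCompatible h hP
  rw [show transposeIdeal T P.asIdeal = _ from hram] at hI
  refine hI.of_mem_minimalPrimes hp (Ideal.radical_isRadical _) ?_
  rw [Ideal.radical_minimalPrimes]
  have h1 := Ideal.IsIntegral.mem_minimalPrimes_map_under (R := R) Q.asIdeal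
  rwa [show Q.asIdeal.under R = P.asIdeal from congrArg PrimeSpectrum.asIdeal hQ] at h1

end Fibers

/-! ### The main theorem -/

theorem mainTheorem9 {p : ℕ} [Fact p.Prime]
    {R : Type*} [CommRing R] [IsDomain R] [IsNoetherianRing R] [IsLocalRing R]
    [IsIntegrallyClosed R] [CharP R p] (hFfin : (frobenius R p).Finite)
    {S : Type*} [CommRing S] [Algebra R S] [Module.Finite R S]
    {Γ : Type*} [AddCommGroup Γ] [Finite Γ] [DecidableEq Γ]
    (𝒜 : Γ → Submodule R S) [GradedAlgebra 𝒜] (h𝒜 : IsDegreeZeroPart 𝒜)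
    (𝒟 : DivisorialPresentation 𝒜) (hCl : Function.Injective 𝒟.toClassGroup)
    {e : ℕ} (he : 0 < e) (φ : CartierMap p e R) (hφ : φ.IsFPure) :
    ∃ ψ : CartierMap p e S,
      IsTransposition (degreeZeroProj 𝒜 h𝒜) φ ψ ∧
      (∀ ψ' : CartierMap p e S, IsTransposition (degreeZeroProj 𝒜 h𝒜) φ ψ' → ψ' = ψ) ∧
      (∀ P ∈ φ.Schpec, IsTamelyRamified (degreeZeroProj 𝒜 h𝒜) P) ∧
      IsFibered (degreeZeroProj 𝒜 h𝒜) φ ψ ∧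
      (∀ P : PrimeSpectrum R, P ∈ φ.Schpec ↔ fiberSet S P ⊆ ψ.Schpec) ∧
      (∀ P : PrimeSpectrum R, P ∈ φ.Schpec ↔ (fiberSet S P ∩ ψ.Schpec).Nonempty) ∧
      (IsPGroup p (Multiplicative Γ) →
        ∃ h : ψ.Schpec ≃ₜ φ.Schpec,
          ∀ Q : ψ.Schpec, (h Q : PrimeSpectrum R) =
            PrimeSpectrum.comap (algebraMap R S) (Q : PrimeSpectrum S)) := by
  have hprime : p.Prime := Fact.out
  have hp : 1 < p ^ e := Nat.one_lt_pow he.ne' hprime.one_lt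
  have hp0 : p ^ e ≠ 0 := (zero_lt_one.trans hp).ne'
  have : CharP S p := charP_of_injective_algebraMap h𝒜.1 p
  have hle := transposeIdeal_degreeZeroProj_le_radical 𝒜 h𝒜
  have hnd : ∀ s, (∀ t, degreeZeroProj 𝒜 h𝒜 (s * t) = 0) → s = 0 := fun _ hs =>
    𝒟.eq_zero_of_forall_degreeZeroProj_mul h𝒜 hs
  have hunit : ∀ s, IsUnit (degreeZeroProj 𝒜 h𝒜 s) → IsUnit s := fun _ hs =>
    𝒟.isUnit_of_degreeZeroProj_isUnit h𝒜 hCl hs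
  have hφs := hφ.surjective
  obtain ⟨ψ, hψ⟩ := CartierMap.exists_forall_apply_eq (T := degreeZeroProj 𝒜 h𝒜) hnd
    (𝒟.exists_forall_degreeZeroProj_mul h𝒜) φ
  have hψs : Function.Surjective ψ := by
    obtain ⟨a, ha⟩ := hφs 1
    refine ψ.surjective_of_apply_isUnit (a := algebraMap R S a) (hunit _ ?_)
    rw [hψ, degreeZeroProj_algebraMap, ha]
    exact isUnit_one
  -- Surjectivity of ψ makes P^T radical, so it contains √(PS) and not only PS.
  have hram : ∀ P ∈ φ.CSpec, IsTamelyRamified (degreeZeroProj 𝒜 h𝒜) P := fun P hP =>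
    le_antisymm (hle _) ((((transposeIdeal_isCompatible hψ hP).isRadical hψs hp).radical_le_iff).2
      (map_le_transposeIdeal _ _))
  have hfib := isFibered_of_surjective hp (degreeZeroProj_one 𝒜 h𝒜) hψ hψs hφs hle
  have hsub : ∀ P ∈ φ.Schpec, fiberSet S P ⊆ ψ.Schpec := fun P hP =>
    (fiberSet_subset_CSpec hp0 hψ hP.1 (hram P hP.1)).trans
      (CartierMap.CSpec_subset_Schpec hψs hp0)
  have hmeet : ∀ P, (fiberSet S P ∩ ψ.Schpec).Nonempty → P ∈ φ.Schpec := by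
    rintro _ ⟨Q, rfl, hQ⟩
    exact CartierMap.CSpec_subset_Schpec hφs hp0
      (isCompatible_comap_of_isCompatible he h𝒜 hnd hunit hφs hψ hQ.1)
  have hne : ∀ P, (fiberSet S P).Nonempty := fun P => by
    have : FaithfulSMul R S := (faithfulSMul_iff_algebraMap_injective R S).2 h𝒜.1
    exact Algebra.IsIntegral.comap_surjective R S P
  refine ⟨ψ, hfib.toIsTransposition, fun ψ' hψ' => CartierMap.eq_of_comm hnd hψ hψ'.comm,
    fun P hP => hram P hP.1, hfib, fun P => ⟨hsub P, fun h => ?_⟩,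
    fun P => ⟨fun h => ?_, hmeet P⟩, fun hΓ => ?_⟩
  · obtain ⟨Q, hQ⟩ := hne P
    exact hmeet P ⟨Q, hQ, h hQ⟩
  · obtain ⟨Q, hQ⟩ := hne P
    exact ⟨Q, hQ, hsub P h hQ⟩
  · obtain ⟨k, hk⟩ := IsPGroup.iff_card.1 hΓ
    have hcard : ∀ γ : Γ, p ^ k • γ = 0 := fun γ => by
      rw [← hk]; exact card_nsmul_eq_zero' (G := Γ) (x := γ)
    -- For a p-group of order p^k, all p^k-th powers of S lie in R, so the whole map of spectra is a
    -- homeomorphism; it then restricts to the centers.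
    have hhomeo : IsHomeomorph (PrimeSpectrum.comap (algebraMap R S)) := by
      refine PrimeSpectrum.isHomeomorph_comap _ (fun s => ⟨p ^ k, pow_pos hprime.pos k, ?_⟩) ?_
      · refine (h𝒜.2 _).1 (pow_mem_of_mem_gradedSubalgebra 𝒜 (H := ⊤) (fun γ _ => hcard γ)
          (mem_gradedSubalgebra_of_decompose 𝒜 fun γ hγ => absurd (AddSubgroup.mem_top γ) hγ))
      · rw [(RingHom.injective_iff_ker_eq_bot _).1 h𝒜.1]
        exact bot_le
    refine ⟨(hhomeo.homeomorph _).subtype fun Q => ⟨fun hQ => hmeet _ ⟨Q, rfl, hQ⟩,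
      fun hP => hsub _ hP rfl⟩, fun Q => rfl⟩
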